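/- Let $\mathfrak g$ be the $N=1$ BMS superalgebra: the complex Lie superalgebra with even basis elements $L_n, M_n$ ($n\in\mathbb Z$), $\mathbf c_1,\mathbf c_2$, odd basis elements $Q_r$ ($r\in\mathbb Z+\frac12$), and brackets $$[L_m,L_n]=(m-n)L_{m+n}+\tfrac{1}{12}\delta_{m+n,0}(m^3-m)\mathbf c_1,\qquad [L_m,M_n]=(m-n)M_{m+n}+\tfrac1{12}\delta_{m+n,0}(m^3-m)\mathbf c_2,$$ $$[Q_r,Q_s]=2M_{r+s}+\tfrac13\delta_{r+s,0}\left(r^2-\tfrac14\right)\mathbf c_2,\qquad [L_m,Q_r]=\left(\tfrac m2-r\right)Q_{m+r},$$ $$[M_m,M_n]=[M_n,Q_r]=0,\qquad [\mathbf c_1,\mathfrak g]=[\mathbf c_2,\mathfrak g]=0.$$ Let $\mathfrak g_0=\mathbb CL_0\oplus\mathbb CM_0\oplus\mathbb C\mathbf c_1\oplus\mathbb C\mathbf c_2$ and let $\mathfrak g_+$ be the span of all $L_n,M_n$ with $n\ge 1$ and all $Q_r$ with $r\ge\frac12$. For $h_1,h_2,c_1,c_2\in\mathbb C$, let the Verma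 module be $$M_{\mathfrak g}(h_1,h_2,c_1,c_2)=U(\mathfrak g)\otimes_{U(\mathfrak g_0\oplus\mathfrak g_+)}\mathbb C,$$ where $U(\cdot)$ denotes the universal enveloping algebra and $\mathbb C$ is the one-dimensional $(\mathfrak g_0\oplus\mathfrak g_+)$-module on which $L_0,M_0,\mathbf c_1,\mathbf c_2$ act by $h_1,h_2,c_1,c_2$ respectively and $\mathfrak g_+$ acts by zero. **Theorem 3.2.** For all $h_1,h_2,c_1,c_2\in\mathbb C$, the $U(\mathfrak g)$-module $M_{\mathfrak g}(h_1,h_2,c_1,c_2)$ is simple if and only if $$h_2+\frac{i^2-1}{24}\,c_2\neq 0\quad\text{for every positive integer } i.$$ -/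

import Mathlib

noncomputable section

/-- A complex Lie superalgebra on the vector space `V`: a `ℤ/2`-grading `V = V₀ ⊕ V₁` and a
bilinear even bracket that is super skew-symmetric and satisfies the super Jacobi identity. -/
structure LieSuperalgebra (V : Type*) [AddCommGroup V] [Module ℂ V] where
  /-- The homogeneous parts; `part 0` is the even part and `part 1` the odd part. -/
  part : ZMod 2 → Submodule ℂ V
  isCompl_part : IsCompl (part 0) (part 1)
  /-- The super bracket. -/
  bracket : V →ₗ[ℂ] V →ₗ[ℂ] V
  bracket_mem : ∀ (i j : ZMod 2) (x y : V), x ∈ part i → y ∈ part j →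
    bracket x y ∈ part (i + j)
  bracket_skew : ∀ (i j : ZMod 2) (x y : V), x ∈ part i → y ∈ part j →
    bracket x y = -((-1 : ℂ) ^ (i.val * j.val) • bracket y x)
  bracket_jacobi : ∀ (i j k : ZMod 2) (x y z : V), x ∈ part i → y ∈ part j → z ∈ part k →
    bracket x (bracket y z) =
      bracket (bracket x y) z + (-1 : ℂ) ^ (i.val * j.val) • bracket y (bracket x z)

namespace LieSuperalgebra

variable {V : Type*} [AddCommGroup V] [Module ℂ V] (S : LieSuperalgebra V)

/-- The relations `x y - (-1)^{|x||y|} y x = [x, y]`, for homogeneous `x`, `y`, imposed on the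
tensor algebra to form the universal enveloping algebra. -/
inductive EnvelopingRel : TensorAlgebra ℂ V → TensorAlgebra ℂ V → Prop
  | mk (i j : ZMod 2) (x y : V) (hx : x ∈ S.part i) (hy : y ∈ S.part j) :
      EnvelopingRel
        (TensorAlgebra.ι ℂ x * TensorAlgebra.ι ℂ y
          - (-1 : ℂ) ^ (i.val * j.val) • (TensorAlgebra.ι ℂ y * TensorAlgebra.ι ℂ x))
        (TensorAlgebra.ι ℂ (S.bracket x y))

/-- The universal enveloping algebra of a Lie superalgebra. -/
abbrev Enveloping : Type _ := RingQuot S.EnvelopingRel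

/-- The canonical linear map from a Lie superalgebra to its universal enveloping algebra. -/
def toEnveloping : V →ₗ[ℂ] S.Enveloping :=
  (RingQuot.mkAlgHom ℂ S.EnvelopingRel).toLinearMap ∘ₗ TensorAlgebra.ι ℂ

end LieSuperalgebra

namespace BMS

/-- Labels of the standard basis of the `N = 1` BMS superalgebra. The label `Q n` stands for the
odd element with half-integer index `n + 1/2`. -/
inductive Label : Type
  | L (n : ℤ)
  | M (n : ℤ)
  | Q (n : ℤ)
  | c₁
  | c₂

/-- The parity of a basis element: the `Q`'s are odd, all others are even. -/
def Label.parity : Label → ZMod 2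
  | .Q _ => 1
  | _ => 0

/-- The degree (index) of a basis element in the `½ℤ`-grading. -/
def Label.degree : Label → ℚ
  | .L n => n
  | .M n => n
  | .Q n => n + 1 / 2
  | .c₁ => 0
  | .c₂ => 0

/-- The underlying vector space of the `N = 1` BMS superalgebra. -/
abbrev Carrier : Type := Label →₀ ℂ

/-- A basis element, as a vector. -/
abbrev e (a : Label) : Carrier := Finsupp.single a 1

/-- The brackets of the basis elements:
`[L_m, L_n] = (m - n) L_{m+n} + δ_{m+n,0} (m³ - m)/12 c₁`,
`[L_m, M_n] = (m - n) M_{m+n} + δ_{m+n,0} (m³ - m)/12 c₂`,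
`[L_m, Q_r] = (m/2 - r) Q_{m+r}`,
`[Q_r, Q_s] = 2 M_{r+s} + δ_{r+s,0} (r² - 1/4)/3 c₂`,
the brackets in the opposite order follow by skew-symmetry, and all others vanish.
In the code `r = n + 1/2` and `s = k + 1/2`, so that `r + s = n + k + 1`. -/
def bracketBasis : Label → Label → Carrier
  | .L m, .L n => ((m : ℂ) - n) • e (.L (m + n))
      + (if m + n = 0 then ((m : ℂ) ^ 3 - m) / 12 else 0) • e .c₁
  | .L m, .M n => ((m : ℂ) - n) • e (.M (m + n))
      + (if m + n = 0 then ((m : ℂ) ^ 3 - m) / 12 else 0) • e .c₂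
  | .M n, .L m => -(((m : ℂ) - n) • e (.M (m + n))
      + (if m + n = 0 then ((m : ℂ) ^ 3 - m) / 12 else 0) • e .c₂)
  | .L m, .Q n => ((m : ℂ) / 2 - (n + 1 / 2)) • e (.Q (m + n))
  | .Q n, .L m => -(((m : ℂ) / 2 - (n + 1 / 2)) • e (.Q (m + n)))
  | .Q n, .Q k => (2 : ℂ) • e (.M (n + k + 1))
      + (if n + k + 1 = 0 then (1 / 3 : ℂ) * (((n : ℂ) + 1 / 2) ^ 2 - 1 / 4) else 0) • e .c₂
  | _, _ => 0

/-- The bilinear extension of `bracketBasis`. -/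
def bracket : Carrier →ₗ[ℂ] Carrier →ₗ[ℂ] Carrier :=
  Finsupp.linearCombination ℂ fun a => Finsupp.linearCombination ℂ (bracketBasis a)

/-- The part of parity `i`: the span of the basis elements of parity `i`. -/
def part (i : ZMod 2) : Submodule ℂ Carrier :=
  Submodule.span ℂ (e '' {a | a.parity = i})

theorem bracket_e (a b : Label) : bracket (e a) (e b) = bracketBasis a b := by
  simp [bracket, e]

theorem part_eq (i : ZMod 2) : part i = Finsupp.supported ℂ ℂ {a | a.parity = i} :=
  (Finsupp.supported_eq_span_single ℂ _).symm

theorem e_mem_part {a : Label} {i : ZMod 2} (h : a.parity = i) : e a ∈ part i :=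
  Submodule.subset_span ⟨a, h, rfl⟩

theorem isCompl_part : IsCompl (part 0) (part 1) := by
  rw [part_eq, part_eq]
  have h : {a : Label | a.parity = 1} = {a : Label | a.parity = 0}ᶜ := by
    ext a
    cases a <;> simp [Label.parity]
  rw [h]
  exact ⟨Finsupp.disjoint_supported_supported disjoint_compl_right,
    Finsupp.codisjoint_supported_supported (by
      rw [codisjoint_iff]; exact sup_compl_eq_top)⟩

theorem bracketBasis_mem (a b : Label) : bracketBasis a b ∈ part (a.parity + b.parity) := by
  have h2 : (1 : ZMod 2) + 1 = 0 := by decide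
  have hL (n : ℤ) : e (.L n) ∈ part 0 := e_mem_part rfl
  have hM (n : ℤ) : e (.M n) ∈ part 0 := e_mem_part rfl
  have hQ (n : ℤ) : e (.Q n) ∈ part 1 := e_mem_part rfl
  have hc₁ : e .c₁ ∈ part 0 := e_mem_part rfl
  have hc₂ : e .c₂ ∈ part 0 := e_mem_part rfl
  rcases a with m | m | m | _ | _ <;> rcases b with n | n | n | _ | _ <;>
    simp only [bracketBasis, Label.parity, h2, zero_add, add_zero, Submodule.zero_mem]
  · exact add_mem (Submodule.smul_mem _ _ (hL _)) (Submodule.smul_mem _ _ hc₁)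
  · exact add_mem (Submodule.smul_mem _ _ (hM _)) (Submodule.smul_mem _ _ hc₂)
  · exact Submodule.smul_mem _ _ (hQ _)
  · exact neg_mem (add_mem (Submodule.smul_mem _ _ (hM _)) (Submodule.smul_mem _ _ hc₂))
  · exact neg_mem (Submodule.smul_mem _ _ (hQ _))
  · exact add_mem (Submodule.smul_mem _ _ (hM _)) (Submodule.smul_mem _ _ hc₂)

theorem bracketBasis_skew (a b : Label) : bracketBasis a b =
    -((-1 : ℂ) ^ (a.parity.val * b.parity.val) • bracketBasis b a) := by
  have h1 : (1 : ZMod 2).val = 1 := rfl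
  have h0 : (0 : ZMod 2).val = 0 := rfl
  rcases a with m | m | m | _ | _ <;> rcases b with n | n | n | _ | _ <;>
    simp only [bracketBasis, Label.parity, h0, h1, mul_zero, mul_one, pow_zero,
      pow_one, one_smul, neg_zero, smul_zero, neg_neg, neg_smul]
  · rw [add_comm n m]
    split_ifs with h
    · have : (n : ℂ) = -m := by
        have : n = -m := by omega
        simp [this]
      rw [this]
      module
    · module
  · rw [add_comm n m]
    split_ifs with h
    · have : (n : ℂ) = -m - 1 := by
        have : n = -m - 1 := by omega
        simp [this]
      rw [this]
      module
    · module

set_option maxHeartbeats 1000000 in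
theorem bracketBasis_jacobi (a b c : Label) :
    bracket (e a) (bracketBasis b c) = bracket (bracketBasis a b) (e c)
      + (-1 : ℂ) ^ (a.parity.val * b.parity.val) • bracket (e b) (bracketBasis a c) := by
  have h1 : (1 : ZMod 2).val = 1 := rfl
  have h0 : (0 : ZMod 2).val = 0 := rfl
  rcases a with m | m | m | _ | _ <;> rcases b with n | n | n | _ | _ <;>
    rcases c with k | k | k | _ | _ <;>
    simp only [bracketBasis, bracket_e, Label.parity, h0, h1, mul_zero, mul_one,
      pow_zero, pow_one, one_smul, neg_zero, smul_zero, neg_neg, neg_smul, map_add, map_neg,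
      map_smul, map_zero, add_zero, LinearMap.add_apply, LinearMap.neg_apply,
      LinearMap.smul_apply, LinearMap.zero_apply]
  all_goals simp only [@add_assoc ℤ, @add_left_comm ℤ, @add_comm ℤ _]
  all_goals push_cast
  all_goals first
    | module
    | split_ifs with h
      · have hm : (m : ℂ) = -n - k := by
          have : m = -n - k := by omega
          rw [this]; push_cast; ring
        rw [hm]; module
      · module
    | split_ifs with h
      · have hm : (m : ℂ) = -n - k - 1 := by
          have : m = -n - k - 1 := by omega
          rw [this]; push_cast; ring
        rw [hm]; module
      · module

theorem bracket_mem (i j : ZMod 2) (x y : Carrier) (hx : x ∈ part i) (hy : y ∈ part j) :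
    bracket x y ∈ part (i + j) := by
  induction hx using Submodule.span_induction with
  | zero => simp
  | add u v _ _ hu hv => simpa using add_mem hu hv
  | smul t u _ hu => simpa using Submodule.smul_mem _ t hu
  | mem u hu =>
    obtain ⟨a, rfl, rfl⟩ := hu
    induction hy using Submodule.span_induction with
    | zero => simp
    | add u v _ _ hu hv => simpa using add_mem hu hv
    | smul t u _ hu => simpa using Submodule.smul_mem _ t hu
    | mem u hu =>
      obtain ⟨b, rfl, rfl⟩ := hu
      rw [bracket_e]
      exact bracketBasis_mem a b

theorem bracket_skew (i j : ZMod 2) (x y : Carrier) (hx : x ∈ part i) (hy : y ∈ part j) :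
    bracket x y = -((-1 : ℂ) ^ (i.val * j.val) • bracket y x) := by
  induction hx using Submodule.span_induction with
  | zero => simp
  | add u v _ _ hu hv => simp only [map_add, LinearMap.add_apply, hu, hv]; module
  | smul t u _ hu => simp only [map_smul, LinearMap.smul_apply, hu]; module
  | mem u hu =>
    obtain ⟨a, rfl, rfl⟩ := hu
    induction hy using Submodule.span_induction with
    | zero => simp
    | add u v _ _ hu hv => simp only [map_add, LinearMap.add_apply, hu, hv]; module
    | smul t u _ hu => simp only [map_smul, LinearMap.smul_apply, hu]; module
    | mem u hu =>
      obtain ⟨b, rfl, rfl⟩ := hu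
      rw [bracket_e, bracket_e]
      exact bracketBasis_skew a b

theorem bracket_jacobi (i j k : ZMod 2) (x y z : Carrier) (hx : x ∈ part i) (hy : y ∈ part j)
    (hz : z ∈ part k) : bracket x (bracket y z) =
      bracket (bracket x y) z + (-1 : ℂ) ^ (i.val * j.val) • bracket y (bracket x z) := by
  induction hx using Submodule.span_induction with
  | zero => simp
  | add u v _ _ hu hv => simp only [map_add, LinearMap.add_apply, hu, hv]; module
  | smul t u _ hu => simp only [map_smul, LinearMap.smul_apply, hu]; module
  | mem u hu =>
    obtain ⟨a, rfl, rfl⟩ := hu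
    induction hy using Submodule.span_induction with
    | zero => simp
    | add u v _ _ hu hv => simp only [map_add, LinearMap.add_apply, hu, hv]; module
    | smul t u _ hu => simp only [map_smul, LinearMap.smul_apply, hu]; module
    | mem u hu =>
      obtain ⟨b, rfl, rfl⟩ := hu
      induction hz using Submodule.span_induction with
      | zero => simp
      | add u v _ _ hu hv => simp only [map_add, hu, hv]; module
      | smul t u _ hu => simp only [map_smul, hu]; module
      | mem u hu =>
        obtain ⟨c, rfl, rfl⟩ := hu
        rw [bracket_e, bracket_e, bracket_e]
        exact bracketBasis_jacobi a b c

/-- The `N = 1` BMS superalgebra `𝔤`. -/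
def superalgebra : LieSuperalgebra Carrier where
  part := part
  isCompl_part := isCompl_part
  bracket := bracket
  bracket_mem := bracket_mem
  bracket_skew := bracket_skew
  bracket_jacobi := bracket_jacobi

/-- The universal enveloping algebra `U(𝔤)`. -/
abbrev U : Type := superalgebra.Enveloping

/-- The subalgebra `𝔤₀ ⊕ 𝔤₊`, spanned by the basis elements of nonnegative degree. -/
def borel : Submodule ℂ Carrier :=
  Submodule.span ℂ (e '' {a | 0 ≤ a.degree})

/-- The values of the highest weight on the basis elements: `L₀ ↦ h₁`, `M₀ ↦ h₂`, `c₁ ↦ c₁`,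
`c₂ ↦ c₂`, and all others go to zero. -/
def weightBasis (h₁ h₂ c₁ c₂ : ℂ) : Label → ℂ
  | .L n => if n = 0 then h₁ else 0
  | .M n => if n = 0 then h₂ else 0
  | .Q _ => 0
  | .c₁ => c₁
  | .c₂ => c₂

/-- The linear functional whose restriction to `𝔤₀ ⊕ 𝔤₊` is the action of `𝔤₀ ⊕ 𝔤₊` on its
one-dimensional module `ℂ` of weight `(h₁, h₂, c₁, c₂)`. -/
def weight (h₁ h₂ c₁ c₂ : ℂ) : Carrier →ₗ[ℂ] ℂ :=
  Finsupp.linearCombination ℂ (weightBasis h₁ h₂ c₁ c₂)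

/-- The left ideal of `U(𝔤)` generated by all `x - χ(x)` with `x` in `𝔤₀ ⊕ 𝔤₊`, where `χ` is the
weight `(h₁, h₂, c₁, c₂)`. -/
def vermaIdeal (h₁ h₂ c₁ c₂ : ℂ) : Submodule U U :=
  Submodule.span U {u | ∃ x ∈ borel,
    u = superalgebra.toEnveloping x - algebraMap ℂ U (weight h₁ h₂ c₁ c₂ x)}

/-- The Verma module `U(𝔤) ⊗_{U(𝔤₀ ⊕ 𝔤₊)} ℂ`, as the quotient of `U(𝔤)` by the left ideal
generated by all `x - χ(x)` with `x` in `𝔤₀ ⊕ 𝔤₊`; the class of `1` is the highest weight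
vector. -/
abbrev Verma (h₁ h₂ c₁ c₂ : ℂ) : Type := U ⧸ vermaIdeal h₁ h₂ c₁ c₂

end BMS

end

/-! Write θ(i) = h₂ + (i² - 1)c₂/24. On a highest weight vector the bracket of `L_n` with `M_{-n}`
acts by 2nθ(n), and the bracket of `Q_r` with `Q_{-r}` by 2θ(2r), so the θ(i) control all the
pairings between raising and lowering letters.

Suppose no θ(i) vanishes. The module is spanned by words: letters L in front, then Q, then M,
applied to the highest weight vector. The letters are stripped one kind at a time: the L's with the
positive M's, the Q's with the positive Q's, the M's with the positive L's. Within each layer the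
stripping operators form a triangular system with these nonzero scalars on the diagonal, so suitable
combinations d_s act like partial derivatives in the letters a_s, up to shorter words, and the Euler
operator ∑ a_s d_s counts letters (`euler_mem_wordFil`). If an invariant subspace missed the base of
a layer, a shortest nonzero vector in it would be killed by every d_s, hence have no letters at all:
a contradiction (`IsLowering.exists_mem_base`). Only spanning is used here, not independence of the
words.

Suppose θ(i) = 0. Put M(z) = ∑ M_k z^{-k-2} and consider (c₂/6)ψ'' + M(z)ψ = 0 with ψ = ∑ y_n
z^{ρ+n}, y_0 the highest weight vector. As `M_0` acts by h₂ on words in the M's, θ(i) = 0 says that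
the exponents are (1 ± i)/2. Starting from the smaller one, the Frobenius recursion breaks down at n
= i, and the obstruction ∑_{j<i} M_{j-i} y_j is a singular vector (`frobeniusSum_isHighestWeight`).
The submodule it generates has `L_0`-eigenvalues h₁ + i + k/2 with k ≥ 0, so it misses the highest
weight vector. If c₂ = 0 the recursion is unavailable, but then h₂ = 0 and i = 1 works, with
singular vector `M_{-1} v`.

That the highest weight vector and the obstruction are nonzero needs a Poincaré–Birkhoff–Witt
argument: 𝔤 is made to act on formal normal words, and the bracket relations are checked by
induction on length (`supercommute_word`). -/

noncomputable section

/-! ### Normal words and the recursive action of letters on them. -/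

namespace BMS

open Finsupp

/-- A height function ordering the labels; the labels of negative degree are those of negative
height, on which the height is injective. -/
def key : Label → ℤ
  | .L n => 3 * n
  | .M n => 3 * n + 1
  | .Q n => 3 * n + 2
  | .c₁ => 0
  | .c₂ => 0

theorem eq_of_key_eq {a b : Label} (h : key a = key b) (ha : key a < 0) : a = b := by
  rcases a with m | m | m | _ | _ <;> rcases b with n | n | n | _ | _ <;>
    simp only [key] at h ha <;> first | omega | (congr 1; omega)

/-- The order allowed for adjacent letters of a normal word: odd letters may not repeat. -/
def Precedes (x y : Label) : Prop := key x < key y ∨ (x = y ∧ x.parity = 0)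

theorem Precedes.trans {x y z : Label} (h : Precedes x y) (h' : Precedes y z) :
    Precedes x z := by
  rcases h with h | ⟨rfl, h⟩
  · rcases h' with h' | ⟨rfl, h'⟩
    · exact .inl (h.trans h')
    · exact .inl h
  · exact h'

/-- The normal words, which index the Poincaré–Birkhoff–Witt basis of the Verma module. -/
def IsNormal (l : List Label) : Prop := (∀ x ∈ l, key x < 0) ∧ l.Pairwise Precedes

theorem isNormal_nil : IsNormal [] := ⟨by simp, List.Pairwise.nil⟩

theorem IsNormal.tail {x : Label} {l : List Label} (h : IsNormal (x :: l)) : IsNormal l :=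
  ⟨fun y hy => h.1 y (List.mem_cons_of_mem _ hy), h.2.of_cons⟩

theorem IsNormal.key_neg {x : Label} {l : List Label} (h : IsNormal (x :: l)) : key x < 0 :=
  h.1 x List.mem_cons_self

theorem isNormal_singleton {x : Label} : IsNormal [x] ↔ key x < 0 := by
  simp [IsNormal]

theorem isNormal_cons_cons {x y : Label} {w : List Label} (h : IsNormal (y :: w)) :
    IsNormal (x :: y :: w) ↔ key x < 0 ∧ Precedes x y := by
  constructor
  · intro h'
    exact ⟨h'.key_neg, List.rel_of_pairwise_cons h'.2 List.mem_cons_self⟩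
  · rintro ⟨hx, hxy⟩
    refine ⟨?_, List.pairwise_cons.2 ⟨?_, h.2⟩⟩
    · intro z hz
      rcases List.mem_cons.1 hz with rfl | hz
      · exact hx
      · exact h.1 z hz
    · intro z hz
      rcases List.mem_cons.1 hz with rfl | hz
      · exact hxy
      · exact hxy.trans (List.rel_of_pairwise_cons h.2 hz)

/-- A letter smaller than `x` that may precede `w` may precede any reordering of `x :: w`. -/
theorem IsNormal.cons_of_perm {x y : Label} {w l : List Label} (h : IsNormal (y :: w))
    (hxy : key y < key x) (hl : IsNormal l) (hp : l.Perm (x :: w)) : IsNormal (y :: l) := by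
  refine ⟨?_, List.pairwise_cons.2 ⟨?_, hl.2⟩⟩
  · intro z hz
    rcases List.mem_cons.1 hz with rfl | hz
    · exact h.key_neg
    · exact hl.1 z hz
  · intro z hz
    rcases List.mem_cons.1 (hp.subset hz) with rfl | hz
    · exact .inl hxy
    · exact List.rel_of_pairwise_cons h.2 hz

/-- The vector space on all words. -/
abbrev Words : Type := List Label →₀ ℂ

/-- A word, as a vector. -/
abbrev word (l : List Label) : Words := single l 1

/-- The sign `(-1)^{|x||y|}`. -/
def sgn (x y : Label) : ℂ := (-1) ^ (x.parity.val * y.parity.val)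

open Classical in
/-- Prepend the letter `y` where this gives a normal word, and act by `A y` elsewhere. -/
def prepend (A : Carrier →ₗ[ℂ] Words →ₗ[ℂ] Words) (y : Label) : Words →ₗ[ℂ] Words :=
  linearCombination ℂ fun u => if IsNormal (y :: u) then word (y :: u) else A (e y) (word u)

variable (χ : Carrier →ₗ[ℂ] ℂ)

open Classical in
/-- The action of a letter on a word, in terms of an action `A` on shorter words. -/
def actStep (A : Carrier →ₗ[ℂ] Words →ₗ[ℂ] Words) (x : Label) (u : List Label) : Words :=
  if IsNormal (x :: u) then word (x :: u) else
    match u with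
    | [] => χ (e x) • word []
    | y :: w =>
      -- When `y :: w` is normal this branch is reached only for odd `x`, and there `x x = [x, x] /
      -- 2` is forced.
      if x = y then (1 / 2 : ℂ) • A (bracket (e x) (e x)) (word w)
      -- `A` is reliable only on words shorter than `y :: w`, but `A (e x) (word w)` also has terms
      -- of that length. `prepend` treats them without calling `A`, since `y` may be put in front of
      -- them.
      else sgn x y • prepend A y (A (e x) (word w)) + A (bracket (e x) (e y)) (word w)

/-- The action, correct on normal words of length less than `n`. -/
def actAux : ℕ → Carrier →ₗ[ℂ] Words →ₗ[ℂ] Words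
  | 0 => 0
  | n + 1 => linearCombination ℂ fun x => linearCombination ℂ (actStep χ (actAux n) x)

theorem actAux_succ (n : ℕ) (x : Label) (u : List Label) :
    actAux χ (n + 1) (e x) (word u) = actStep χ (actAux χ n) x u := by
  simp [actAux]

/-- The span of the normal words of length at most `k`. -/
def lengthLE (k : ℕ) : Submodule ℂ Words :=
  Submodule.span ℂ (word '' {l | IsNormal l ∧ l.length ≤ k})

/-- The span of the normal words of length at most `|u|` and of the reorderings of `x :: u`. -/
def leading (x : Label) (u : List Label) : Submodule ℂ Words :=
  Submodule.span ℂ (word '' {l | IsNormal l ∧ (l.length ≤ u.length ∨ l.Perm (x :: u))})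

theorem lengthLE_mono {j k : ℕ} (h : j ≤ k) : lengthLE j ≤ lengthLE k :=
  Submodule.span_mono (Set.image_mono fun _ hl => ⟨hl.1, hl.2.trans h⟩)

theorem lengthLE_le_leading (x : Label) (u : List Label) : lengthLE u.length ≤ leading x u :=
  Submodule.span_mono (Set.image_mono fun _ hl => ⟨hl.1, .inl hl.2⟩)

theorem leading_le_lengthLE (x : Label) (u : List Label) : leading x u ≤ lengthLE (u.length + 1) :=
  Submodule.span_mono (Set.image_mono fun l hl => ⟨hl.1, by
    rcases hl.2 with h | h
    · omega
    · simp [h.length_eq]⟩)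

theorem map_mem_of_forall_label {u : Words} {N : Submodule ℂ Words}
    {A : Carrier →ₗ[ℂ] Words →ₗ[ℂ] Words} (h : ∀ x, A (e x) u ∈ N) (v : Carrier) : A v u ∈ N := by
  induction v using Finsupp.induction_linear with
  | zero => simp
  | add v w hv hw => simpa using add_mem hv hw
  | single a b =>
    have : single a b = b • e a := by simp
    rw [this, map_smul]
    exact N.smul_mem _ (h a)

theorem map_eq_of_forall_label {u : Words}
    {A B : Carrier →ₗ[ℂ] Words →ₗ[ℂ] Words} (h : ∀ x, A (e x) u = B (e x) u) (v : Carrier) :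
    A v u = B v u := by
  induction v using Finsupp.induction_linear with
  | zero => simp
  | add v w hv hw => simp only [map_add, LinearMap.add_apply, hv, hw]
  | single a b =>
    have : single a b = b • e a := by simp
    rw [this, map_smul, map_smul, LinearMap.smul_apply, LinearMap.smul_apply, h]

theorem not_isNormal_cons_cons {x y : Label} {w : List Label} (h : IsNormal (y :: w))
    (hx : ¬ IsNormal (x :: y :: w)) (hne : x ≠ y) : key y < key x := by
  have hy := h.key_neg
  by_contra! hk
  refine hx ((isNormal_cons_cons h).2 ⟨hk.trans_lt hy, .inl (lt_of_le_of_ne hk fun he => ?_)⟩)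
  exact hne (eq_of_key_eq he (by omega))

theorem prepend_of_isNormal {A : Carrier →ₗ[ℂ] Words →ₗ[ℂ] Words} {y : Label} {l : List Label}
    (h : IsNormal (y :: l)) : prepend A y (word l) = word (y :: l) := by
  simp [prepend, h]

theorem prepend_of_not_isNormal {A : Carrier →ₗ[ℂ] Words →ₗ[ℂ] Words} {y : Label} {l : List Label}
    (h : ¬ IsNormal (y :: l)) : prepend A y (word l) = A (e y) (word l) := by
  simp [prepend, h]

/-- The recursion is independent of the bound `n` only because the longest terms of `x · w` are
reorderings of `x :: w`, so the shape of the leading terms and the independence of `n` go through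
one induction. -/
theorem actAux_spec (k : ℕ) : ∀ u : List Label, IsNormal u → u.length = k → ∀ n, k < n → ∀ x,
    actAux χ n (e x) (word u) ∈ leading x u ∧
      actAux χ n (e x) (word u) = actAux χ (k + 1) (e x) (word u) := by
  induction k using Nat.strong_induction_on with
  | _ k ih =>
  intro u hu hk n hn x
  obtain ⟨n, rfl⟩ : ∃ m, n = m + 1 := ⟨n - 1, by omega⟩
  rw [actAux_succ, actAux_succ]
  by_cases hx : IsNormal (x :: u)
  · simp only [actStep, hx, if_true, and_true]
    exact Submodule.subset_span ⟨_, ⟨hx, .inr (List.Perm.refl _)⟩, rfl⟩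
  match u, hu, hk, hx with
  | [], hu, hk, hx =>
    simp only [actStep, hx, if_false, and_true]
    exact Submodule.smul_mem _ _ (Submodule.subset_span ⟨_, ⟨isNormal_nil, .inl le_rfl⟩, rfl⟩)
  | y :: w, hu, hk, hx =>
    have hw := hu.tail
    simp only [List.length_cons] at hk
    have key1 : ∀ m, w.length < m → ∀ v : Carrier, actAux χ m v (word w) ∈ lengthLE k ∧
        actAux χ m v (word w) = actAux χ k v (word w) := by
      intro m hm v
      refine ⟨map_mem_of_forall_label (fun x => ?_) v, map_eq_of_forall_label (fun x => ?_) v⟩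
      · exact hk ▸ leading_le_lengthLE x w ((ih _ (by omega) w hw rfl m hm x).1)
      · rw [(ih _ (by omega) w hw rfl m hm x).2, hk]
    by_cases hxy : x = y
    · subst hxy
      simp only [actStep, hx, if_false, if_true]
      refine ⟨Submodule.smul_mem _ _ (lengthLE_le_leading _ _ ?_), ?_⟩
      · simpa [hk] using (key1 n (by omega) _).1
      · rw [(key1 n (by omega) _).2]
    · have hlt := not_isNormal_cons_cons hu hx hxy
      simp only [actStep, hx, if_false, hxy]
      -- A reordering of `x :: w` remains normal with the smaller letter `y` in front. So `actAux`
      -- is called only on words of length at most that of `w`.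
      have hpre : ∀ m, w.length < m → ∀ t ∈ leading x w,
          prepend (actAux χ m) y t ∈ leading x (y :: w) ∧
            prepend (actAux χ m) y t = prepend (actAux χ k) y t := by
        intro m hm t ht
        induction ht using Submodule.span_induction with
        | zero => simp
        | add s t _ _ hs ht =>
          simp only [map_add]
          exact ⟨add_mem hs.1 ht.1, by rw [hs.2, ht.2]⟩
        | smul c t _ ht =>
          simp only [map_smul]
          exact ⟨Submodule.smul_mem _ _ ht.1, by rw [ht.2]⟩
        | mem t ht =>
          obtain ⟨l, ⟨hl, hlw⟩, rfl⟩ := ht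
          by_cases hyl : IsNormal (y :: l)
          · rw [prepend_of_isNormal hyl, prepend_of_isNormal hyl]
            refine ⟨Submodule.subset_span ⟨_, ⟨hyl, ?_⟩, rfl⟩, rfl⟩
            rcases hlw with h | h
            · exact .inl (by simpa using h)
            · exact .inr ((h.cons y).trans (List.Perm.swap _ _ _))
          · rw [prepend_of_not_isNormal hyl, prepend_of_not_isNormal hyl]
            rcases hlw with h | h
            · have h1 := ih l.length (by omega) l hl rfl
              refine ⟨lengthLE_le_leading _ _ (lengthLE_mono ?_
                (leading_le_lengthLE y l (h1 m (by omega) y).1)), ?_⟩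
              · simpa using h
              · rw [(h1 m (by omega) y).2, (h1 k (by omega) y).2]
            · exact absurd (hu.cons_of_perm hlt hl h) hyl
      have h2 := ih w.length (by omega) w hw rfl
      refine ⟨add_mem (Submodule.smul_mem _ _ (hpre n (by omega) _ (h2 n (by omega) x).1).1)
        (lengthLE_le_leading _ _ ?_), ?_⟩
      · simpa [hk] using (key1 n (by omega) _).1
      · rw [(hpre n (by omega) _ (h2 n (by omega) x).1).2, (key1 n (by omega) _).2,
          (key1 n (by omega) _).2]

/-- The action of `𝔤` on words; it is a representation on the span of the normal words. -/
def act : Carrier →ₗ[ℂ] Words →ₗ[ℂ] Words :=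
  linearCombination ℂ fun x => linearCombination ℂ fun u =>
    actAux χ (u.length + 1) (e x) (word u)

theorem act_e_word (x : Label) (u : List Label) :
    act χ (e x) (word u) = actAux χ (u.length + 1) (e x) (word u) := by
  simp [act]

variable {χ}

theorem actAux_eq_act {n : ℕ} {u : List Label} (hu : IsNormal u) (hn : u.length < n)
    (v : Carrier) : actAux χ n v (word u) = act χ v (word u) :=
  map_eq_of_forall_label (fun x => by
    rw [(actAux_spec χ _ u hu rfl n hn x).2, act_e_word]) v

theorem act_mem_leading (x : Label) {u : List Label} (hu : IsNormal u) :
    act χ (e x) (word u) ∈ leading x u := by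
  rw [← actAux_eq_act hu (Nat.lt_succ_self _)]
  exact (actAux_spec χ _ u hu rfl _ (Nat.lt_succ_self _) x).1

theorem act_mem_lengthLE (v : Carrier) {u : List Label} (hu : IsNormal u) :
    act χ v (word u) ∈ lengthLE (u.length + 1) :=
  map_mem_of_forall_label (fun x => leading_le_lengthLE _ _ (act_mem_leading x hu)) v

theorem act_of_isNormal {x : Label} {u : List Label} (h : IsNormal (x :: u)) :
    act χ (e x) (word u) = word (x :: u) := by
  rw [act_e_word, actAux_succ, actStep.eq_def, if_pos h]

theorem act_nil {x : Label} (h : 0 ≤ key x) : act χ (e x) (word []) = χ (e x) • word [] := by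
  rw [act_e_word, actAux_succ, actStep, if_neg]
  rw [isNormal_singleton]
  omega

theorem act_self {x : Label} {w : List Label} (h : IsNormal (x :: w)) (hx : x.parity = 1) :
    act χ (e x) (act χ (e x) (word w)) = (1 / 2 : ℂ) • act χ (bracket (e x) (e x)) (word w) := by
  rw [act_of_isNormal h, act_e_word, actAux_succ, actStep, if_neg]
  · simp only [if_true, List.length_cons]
    rw [actAux_eq_act h.tail (by omega)]
  · rw [isNormal_cons_cons h]
    rintro ⟨-, hk | ⟨-, hk⟩⟩
    · omega
    · exact absurd (hx.symm.trans hk) (by decide)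

/-- This is the defining recursion, once `prepend` has been identified with the action of `y` on all
terms of `x · w`. It is the case of the bracket relation that holds by construction. -/
theorem act_of_key_lt {x y : Label} {w : List Label} (h : IsNormal (y :: w))
    (hxy : key y < key x) : act χ (e x) (act χ (e y) (word w)) =
      sgn x y • act χ (e y) (act χ (e x) (word w)) + act χ (bracket (e x) (e y)) (word w) := by
  have hne : x ≠ y := fun he => by rw [he] at hxy; omega
  rw [act_of_isNormal h, act_e_word, actAux_succ, actStep, if_neg]
  · simp only [hne, if_false, List.length_cons]
    rw [actAux_eq_act h.tail (by omega), actAux_eq_act h.tail (by omega)]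
    congr 2
    have hm := act_mem_leading (χ := χ) x h.tail
    generalize act χ (e x) (word w) = t at hm
    induction hm using Submodule.span_induction with
    | zero => simp
    | add s t _ _ hs ht => simp only [map_add, hs, ht]
    | smul c t _ ht => simp only [map_smul, ht]
    | mem t ht =>
      obtain ⟨l, ⟨hl, hlw⟩, rfl⟩ := ht
      by_cases hyl : IsNormal (y :: l)
      · rw [prepend_of_isNormal hyl, act_of_isNormal hyl]
      · rw [prepend_of_not_isNormal hyl]
        rcases hlw with hlw | hlw
        · exact actAux_eq_act hl (by omega) _
        · exact absurd (h.cons_of_perm hxy hl hlw) hyl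
  · rw [isNormal_cons_cons h]
    rintro ⟨-, hk | ⟨hk, -⟩⟩
    · omega
    · exact hne hk

end BMS
end

/-! ### The bracket relations on normal words and the resulting representation of `U`. -/

noncomputable section

namespace BMS

open Finsupp

variable {χ : Carrier →ₗ[ℂ] ℂ}

theorem parity_eq_zero_or_one (i : ZMod 2) : i = 0 ∨ i = 1 := by
  revert i; decide

theorem sgn_comm (x y : Label) : sgn x y = sgn y x := by
  rw [sgn, sgn, mul_comm]

theorem sgn_mul_self (x y : Label) : sgn x y * sgn x y = 1 := by
  rw [sgn, ← mul_pow]; simp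

theorem bracket_e_skew (x y : Label) : bracket (e x) (e y) = -(sgn x y • bracket (e y) (e x)) :=
  bracket_skew _ _ _ _ (e_mem_part rfl) (e_mem_part rfl)

/-- The letters `x` and `y` satisfy the bracket relation on the vector `t`. -/
def Supercommute (χ : Carrier →ₗ[ℂ] ℂ) (x y : Label) (t : Words) : Prop :=
  act χ (e x) (act χ (e y) t) = sgn x y • act χ (e y) (act χ (e x) t) +
    act χ (bracket (e x) (e y)) t

theorem Supercommute.symm {x y : Label} {t : Words} (h : Supercommute χ x y t) :
    Supercommute χ y x t := by
  unfold Supercommute at *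
  rw [h, bracket_e_skew x y, sgn_comm y x, smul_add, smul_smul, sgn_mul_self, map_neg, map_smul]
  simp only [LinearMap.neg_apply, LinearMap.smul_apply, smul_neg, smul_smul, sgn_mul_self]
  module

theorem supercommute_of_mem_span {x y : Label} {s : Set Words} {t : Words}
    (ht : t ∈ Submodule.span ℂ s) (h : ∀ t ∈ s, Supercommute χ x y t) : Supercommute χ x y t := by
  unfold Supercommute at *
  induction ht using Submodule.span_induction with
  | zero => simp
  | add a b _ _ ha hb => simp only [map_add, ha, hb]; module
  | smul c a _ ha => simp only [map_smul, ha]; module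
  | mem t ht => exact h t ht

/-- Bracket relations on `t` extend from letters to homogeneous vectors. -/
theorem act_act_of_mem_part {t : Words} (h : ∀ x y, Supercommute χ x y t) {i j : ZMod 2}
    {v w : Carrier} (hv : v ∈ part i) (hw : w ∈ part j) :
    act χ v (act χ w t) =
      (-1 : ℂ) ^ (i.val * j.val) • act χ w (act χ v t) + act χ (bracket v w) t := by
  induction hv using Submodule.span_induction with
  | zero => simp
  | add u v _ _ hu hv => simp only [map_add, LinearMap.add_apply, hu, hv]; module
  | smul c u _ hu => simp only [map_smul, LinearMap.smul_apply, hu]; module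
  | mem u hu =>
    obtain ⟨a, rfl, rfl⟩ := hu
    induction hw using Submodule.span_induction with
    | zero => simp
    | add u v _ _ hu hv => simp only [map_add, LinearMap.add_apply, hu, hv]; module
    | smul c u _ hu => simp only [map_smul, LinearMap.smul_apply, hu]; module
    | mem u hu =>
      obtain ⟨b, rfl, rfl⟩ := hu
      exact h a b

theorem bracket_self_of_even {x : Label} (hx : x.parity = 0) : bracket (e x) (e x) = 0 := by
  have h := bracket_e_skew x x
  have h1 : sgn x x = 1 := by simp [sgn, hx]
  rw [h1, one_smul] at h
  exact self_eq_neg.1 h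

theorem supercommute_self_of_isNormal {x : Label} {u : List Label} (h : IsNormal (x :: u)) :
    Supercommute χ x x (word u) := by
  rcases parity_eq_zero_or_one x.parity with hx | hx
  · simp [Supercommute, sgn, hx, bracket_self_of_even hx]
  · rw [Supercommute, act_self h hx]
    have h1 : sgn x x = -1 := by simp [sgn, hx, ZMod.val_one]
    rw [h1]
    module

theorem supercommute_of_isNormal {x y : Label} {u : List Label} (h : IsNormal (y :: u))
    (hxy : key y ≤ key x) : Supercommute χ x y (word u) := by
  rcases hxy.lt_or_eq with hlt | heq
  · exact act_of_key_lt h hlt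
  · obtain rfl := eq_of_key_eq heq h.key_neg
    exact supercommute_self_of_isNormal h

/-- Pull `z`, which is smaller than both `x` and `y`, to the front of `x y z w` and `y x z w`. The
relations involving `z` hold by construction or by induction, and what is left over is the super
Jacobi identity for `x`, `y`, `z`. -/
theorem supercommute_cons_of_lt {x y z : Label} {w : List Label} (hz : IsNormal (z :: w))
    (hzx : key z < key x) (hzy : key z < key y)
    (ih : ∀ l, IsNormal l → l.length ≤ w.length → ∀ x y, Supercommute χ x y (word l)) :
    Supercommute χ x y (word (z :: w)) := by
  -- The terms of `y · w` are either short enough for the induction hypothesis or reorderings of `y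
  -- :: w`, which may follow `z`.
  have hlead : ∀ {x y : Label}, key z < key x → key z < key y →
      Supercommute χ x z (act χ (e y) (word w)) := by
    intro x y hx hy
    refine supercommute_of_mem_span (act_mem_leading y hz.tail) ?_
    rintro _ ⟨l, ⟨hl, hlw | hlw⟩, rfl⟩
    · exact ih l hl hlw _ _
    · exact supercommute_of_isNormal (hz.cons_of_perm hy hl hlw) hx.le
  have hw := ih w hz.tail le_rfl
  have h1 := hw y z
  have h2 := hw x z
  have h3 := hlead hzx hzy
  have h4 := hlead hzy hzx
  have hp (a : Label) : e a ∈ part a.parity := e_mem_part rfl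
  have hb (a b : Label) : bracket (e a) (e b) ∈ part (a.parity + b.parity) :=
    bracket_mem _ _ _ _ (hp a) (hp b)
  have h5 := act_act_of_mem_part hw (hp x) (hb y z)
  have h6 := act_act_of_mem_part hw (hp y) (hb x z)
  have h7 := act_act_of_mem_part hw (hb x y) (hp z)
  have h8 := hw x y
  have hj := bracket_jacobi _ _ _ _ _ _ (hp x) (hp y) (hp z)
  unfold Supercommute at *
  rw [← act_of_isNormal (χ := χ) hz, h1, h2]
  simp only [map_add, map_smul]
  rw [h3, h4, h5, h6, h7, h8, hj]
  simp only [map_add, map_smul, LinearMap.add_apply, LinearMap.smul_apply, sgn]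
  have e2 : (1 + 1 : ZMod 2) = 0 := by decide
  rcases parity_eq_zero_or_one x.parity with px | px <;>
  rcases parity_eq_zero_or_one y.parity with py | py <;>
  rcases parity_eq_zero_or_one z.parity with pz | pz <;>
  simp only [px, py, pz, ZMod.val_zero, ZMod.val_one, add_zero, zero_add, e2, mul_zero,
    mul_one, pow_zero, pow_one] <;> module

/-- For odd `z`, Jacobi and skew-symmetry together give `3 [z, [z, z]] = 0`. -/
theorem bracket_self_bracket_self (z : Label) :
    bracket (e z) (bracket (e z) (e z)) = 0 := by
  rcases parity_eq_zero_or_one z.parity with hz | hz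
  · simp [bracket_self_of_even hz]
  · have hp : e z ∈ part 1 := e_mem_part hz
    have hj := bracket_jacobi _ _ _ _ _ _ hp hp hp
    have hb := bracket_mem _ _ _ _ hp hp
    have hs := bracket_skew _ _ _ _ hb hp
    have e2 : (1 + 1 : ZMod 2) = 0 := by decide
    rw [hs] at hj
    simp only [e2, ZMod.val_zero, ZMod.val_one, pow_zero, mul_one, pow_one, one_smul,
      neg_smul] at hj
    have h3 : (3 : ℂ) • bracket (e z) (bracket (e z) (e z)) = 0 := by
      linear_combination (norm := module) hj
    exact (smul_eq_zero.1 h3).resolve_left (by norm_num)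

/-- An odd letter cannot be repeated in a normal word, so `z z w` is rewritten as `[z, z] w / 2`.
For `x ≠ z` the relation follows from the Jacobi identity for `x`, `z`, `z`; for `x = z` from `[z,
[z, z]] = 0`. -/
theorem supercommute_cons_of_odd {x z : Label} {w : List Label} (hz : IsNormal (z :: w))
    (hzx : key z ≤ key x) (hodd : z.parity = 1)
    (ih : ∀ l, IsNormal l → l.length ≤ w.length → ∀ x y, Supercommute χ x y (word l)) :
    Supercommute χ x z (word (z :: w)) := by
  have hw := ih w hz.tail le_rfl
  have hp (a : Label) : e a ∈ part a.parity := e_mem_part rfl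
  have hb (a b : Label) : bracket (e a) (e b) ∈ part (a.parity + b.parity) :=
    bracket_mem _ _ _ _ (hp a) (hp b)
  have e2 : (1 + 1 : ZMod 2) = 0 := by decide
  have hself := act_self (χ := χ) hz hodd
  have h5 := act_act_of_mem_part hw (hp x) (hb z z)
  rcases hzx.lt_or_eq with hlt | heq
  · have hlead : act χ (e z) (act χ (e z) (act χ (e x) (word w))) =
        (1 / 2 : ℂ) • act χ (bracket (e z) (e z)) (act χ (e x) (word w)) := by
      have : Supercommute χ z z (act χ (e x) (word w)) := by
        refine supercommute_of_mem_span (act_mem_leading x hz.tail) ?_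
        rintro _ ⟨l, ⟨hl, hlw | hlw⟩, rfl⟩
        · exact ih l hl hlw _ _
        · exact supercommute_of_isNormal (hz.cons_of_perm hlt hl hlw) le_rfl
      have h1 : sgn z z = -1 := by simp [sgn, hodd, ZMod.val_one]
      rw [Supercommute, h1] at this
      linear_combination (norm := module) (1 / 2 : ℂ) • this
    have h2 := hw x z
    have h7 := act_act_of_mem_part hw (hb x z) (hp z)
    have hj := bracket_jacobi _ _ _ _ _ _ (hp x) (hp z) (hp z)
    have hs := bracket_skew _ _ _ _ (hp z) (hb x z)
    unfold Supercommute at *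
    rw [← act_of_isNormal (χ := χ) hz, hself, h2]
    simp only [map_add, map_smul]
    rw [hlead, h5, h7, hj, hs]
    simp only [map_add, map_smul, map_neg, LinearMap.add_apply, LinearMap.smul_apply,
      LinearMap.neg_apply, sgn]
    rcases parity_eq_zero_or_one x.parity with px | px <;>
    simp only [px, hodd, ZMod.val_zero, ZMod.val_one, zero_add, e2, mul_zero,
      mul_one, pow_zero, pow_one] <;> module
  · obtain rfl := eq_of_key_eq heq hz.key_neg
    rw [bracket_self_bracket_self] at h5
    have h1 : sgn z z = -1 := by simp [sgn, hodd, ZMod.val_one]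
    rw [Supercommute, h1, ← act_of_isNormal (χ := χ) hz, hself, map_smul, h5]
    simp only [hodd, e2, ZMod.val_zero, mul_zero, pow_zero, map_zero, LinearMap.zero_apply]
    module

theorem bracketBasis_mem_span_key_nonneg {a b : Label} (ha : 0 ≤ key a) (hb : 0 ≤ key b) :
    bracketBasis a b ∈ Submodule.span ℂ (e '' {a | 0 ≤ key a}) := by
  have h (a : Label) (ha : 0 ≤ key a) : e a ∈ Submodule.span ℂ (e '' {a | 0 ≤ key a}) :=
    Submodule.subset_span ⟨a, ha, rfl⟩
  rcases a with m | m | m | _ | _ <;> rcases b with n | n | n | _ | _ <;>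
    simp only [bracketBasis, Submodule.zero_mem] <;> simp only [key] at ha hb <;>
    (repeat' first | apply add_mem | apply neg_mem | apply Submodule.smul_mem) <;>
    (apply h; simp only [key]; omega)

theorem act_nil_of_mem_span {v : Carrier} (hv : v ∈ Submodule.span ℂ (e '' {a | 0 ≤ key a})) :
    act χ v (word []) = χ v • word [] := by
  induction hv using Submodule.span_induction with
  | zero => simp
  | add a b _ _ ha hb => simp only [map_add, LinearMap.add_apply, ha, hb]; module
  | smul c a _ ha => simp only [map_smul, LinearMap.smul_apply, ha]; module
  | mem v hv =>
    obtain ⟨a, ha, rfl⟩ := hv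
    exact act_nil ha

/-- `χ` restricts to a character of the subalgebra spanned by the labels of nonnegative degree. -/
def IsCharacter (χ : Carrier →ₗ[ℂ] ℂ) : Prop :=
  ∀ a b, 0 ≤ key a → 0 ≤ key b → χ (bracketBasis a b) = 0 ∧ (a.parity = 1 → χ (e a) = 0)

theorem supercommute_nil (hχ : IsCharacter χ) {x y : Label} (hx : 0 ≤ key x) (hy : 0 ≤ key y) :
    Supercommute χ x y (word []) := by
  rw [Supercommute, bracket_e, act_nil_of_mem_span (bracketBasis_mem_span_key_nonneg hx hy),
    (hχ x y hx hy).1, act_nil hx, act_nil hy, map_smul, map_smul, act_nil hx, act_nil hy]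
  rcases parity_eq_zero_or_one x.parity with px | px
  · simp only [sgn, px, ZMod.val_zero, zero_mul, pow_zero]
    module
  · rw [(hχ x y hx hy).2 px]
    module

/-- The cases where `y` cannot precede `u` are: `u` empty, so that both letters act through the
character; `y` equal to the first letter of `u`, necessarily odd; or `y` larger than that letter. -/
theorem supercommute_word (hχ : IsCharacter χ) (k : ℕ) : ∀ u : List Label, IsNormal u →
    u.length = k → ∀ x y, Supercommute χ x y (word u) := by
  induction k using Nat.strong_induction_on with
  | _ k ih =>
  intro u hu hk
  -- The relation is symmetric in the two letters, so only one order of the heights matters.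
  have main : ∀ x y, key y ≤ key x → Supercommute χ x y (word u) := by
    intro x y hxy
    by_cases hyu : IsNormal (y :: u)
    · exact supercommute_of_isNormal hyu hxy
    match u, hu, hk, hyu with
    | [], hu, hk, hyu =>
      have hy : 0 ≤ key y := by
        rw [isNormal_singleton] at hyu; omega
      exact supercommute_nil hχ (hy.trans hxy) hy
    | z :: w, hu, hk, hyu =>
      have ih' : ∀ l, IsNormal l → l.length ≤ w.length →
          ∀ x y, Supercommute χ x y (word l) := by
        intro l hl hlw
        exact ih l.length (by simp at hk; omega) l hl rfl
      by_cases hyz : y = z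
      · subst hyz
        refine supercommute_cons_of_odd hu hxy ?_ ih'
        refine (parity_eq_zero_or_one _).resolve_left fun h0 => hyu ?_
        exact (isNormal_cons_cons hu).2 ⟨hu.key_neg, .inr ⟨rfl, h0⟩⟩
      · have hlt := not_isNormal_cons_cons hu hyu hyz
        exact supercommute_cons_of_lt hu (hlt.trans_le hxy) hlt ih'
  intro x y
  rcases le_total (key y) (key x) with h | h
  · exact main x y h
  · exact (main y x h).symm

/-- The span of the normal words. -/
def normalSpan : Submodule ℂ Words := Submodule.span ℂ (word '' {l | IsNormal l})

theorem lengthLE_le_normalSpan (k : ℕ) : lengthLE k ≤ normalSpan :=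
  Submodule.span_mono (Set.image_mono fun _ hl => hl.1)

theorem act_mem_normalSpan (v : Carrier) {t : Words} (ht : t ∈ normalSpan) :
    act χ v t ∈ normalSpan := by
  induction ht using Submodule.span_induction with
  | zero => simp
  | add a b _ _ ha hb => simpa using add_mem ha hb
  | smul c a _ ha => simpa using Submodule.smul_mem _ c ha
  | mem t ht =>
    obtain ⟨l, hl, rfl⟩ := ht
    exact lengthLE_le_normalSpan _ (act_mem_lengthLE v hl)

theorem act_act {i j : ZMod 2} {v w : Carrier} (hχ : IsCharacter χ) (hv : v ∈ part i)
    (hw : w ∈ part j) {t : Words} (ht : t ∈ normalSpan) :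
    act χ v (act χ w t) =
      (-1 : ℂ) ^ (i.val * j.val) • act χ w (act χ v t) + act χ (bracket v w) t :=
  act_act_of_mem_part (fun x y => supercommute_of_mem_span ht (by
    rintro _ ⟨l, hl, rfl⟩
    exact supercommute_word hχ _ l hl rfl x y)) hv hw

/-- The span of the normal words, as a type. -/
def NormalWords : Type := normalSpan

instance : AddCommGroup NormalWords := inferInstanceAs (AddCommGroup normalSpan)

instance : Module ℂ NormalWords := inferInstanceAs (Module ℂ normalSpan)

/-- The inclusion of the span of the normal words into the space on all words. -/
def toWords : NormalWords →ₗ[ℂ] Words := normalSpan.subtype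

theorem toWords_mem (t : NormalWords) : toWords t ∈ normalSpan := Subtype.prop t

theorem toWords_injective : Function.Injective toWords := Subtype.val_injective

variable (χ) in
/-- The operator by which a vector acts on the span of the normal words. -/
def actNormal : Carrier →ₗ[ℂ] Module.End ℂ NormalWords where
  toFun v := (act χ v).restrict fun _ => act_mem_normalSpan v
  map_add' v w := by
    refine LinearMap.ext fun t => toWords_injective ?_
    change act χ (v + w) (toWords t) = act χ v (toWords t) + act χ w (toWords t)
    simp
  map_smul' c v := by
    refine LinearMap.ext fun t => toWords_injective ?_
    change act χ (c • v) (toWords t) = c • act χ v (toWords t)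
    simp

theorem toWords_actNormal (v : Carrier) (t : NormalWords) :
    toWords (actNormal χ v t) = act χ v (toWords t) := rfl

/-- The representation of `U(𝔤)` on the span of the normal words. -/
def wordRep (hχ : IsCharacter χ) : U →ₐ[ℂ] Module.End ℂ NormalWords :=
  RingQuot.liftAlgHom ℂ ⟨TensorAlgebra.lift ℂ (actNormal χ), by
    rintro _ _ ⟨i, j, x, y, hx, hy⟩
    refine LinearMap.ext fun t => toWords_injective ?_
    have h := act_act hχ hx hy (toWords_mem t)
    simp only [map_sub, map_mul, map_smul, TensorAlgebra.lift_ι_apply, LinearMap.sub_apply,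
      LinearMap.smul_apply, Module.End.mul_apply, toWords_actNormal, h]
    simp [superalgebra]⟩

theorem wordRep_toEnveloping (hχ : IsCharacter χ) (v : Carrier) :
    wordRep hχ (superalgebra.toEnveloping v) = actNormal χ v := by
  simp [wordRep, LieSuperalgebra.toEnveloping]

/-- The empty word, the highest weight vector. -/
def emptyWord : NormalWords :=
  (⟨word [], Submodule.subset_span ⟨[], isNormal_nil, rfl⟩⟩ : normalSpan)

theorem toWords_emptyWord : toWords emptyWord = word [] := rfl

theorem key_nonneg_iff (a : Label) : 0 ≤ key a ↔ 0 ≤ a.degree := by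
  rcases a with m | m | m | _ | _ <;> simp only [key, Label.degree, le_refl]
  · rw [Int.cast_nonneg_iff]; omega
  · rw [Int.cast_nonneg_iff]; omega
  · constructor
    · intro h
      have : (0 : ℤ) ≤ m := by omega
      have : (0 : ℚ) ≤ m := by exact_mod_cast this
      linarith
    · intro h
      have : (-1 : ℚ) < m := by linarith
      have : (-1 : ℤ) < m := by exact_mod_cast this
      omega

theorem weight_e (h₁ h₂ c₁ c₂ : ℂ) (a : Label) :
    weight h₁ h₂ c₁ c₂ (e a) = weightBasis h₁ h₂ c₁ c₂ a := by
  simp [weight]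

/-- A bracket of two letters of nonnegative degree can reach degree zero only if both have degree
zero, and then its coefficients vanish. -/
theorem isCharacter_weight (h₁ h₂ c₁ c₂ : ℂ) : IsCharacter (weight h₁ h₂ c₁ c₂) := by
  intro a b ha hb
  constructor
  · rcases a with m | m | m | _ | _ <;> rcases b with n | n | n | _ | _ <;>
      simp only [bracketBasis, map_zero] <;> simp only [key] at ha hb <;>
      simp only [map_add, map_neg, map_smul, weight_e, weightBasis, smul_zero, neg_zero]
    · split_ifs with h
      · obtain ⟨rfl, rfl⟩ : m = 0 ∧ n = 0 := by omega
        simp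
      · simp
    · split_ifs with h
      · obtain ⟨rfl, rfl⟩ : m = 0 ∧ n = 0 := by omega
        simp
      · simp
    · split_ifs with h
      · obtain ⟨rfl, rfl⟩ : m = 0 ∧ n = 0 := by omega
        simp
      · simp
    · rw [if_neg (by omega), if_neg (by omega)]
      simp
  · intro h
    rcases a with m | m | m | _ | _ <;> simp_all [Label.parity, weight_e, weightBasis]

/-- This lets `u ↦ u · emptyWord` descend to the Verma module. -/
theorem wordRep_emptyWord_of_mem_vermaIdeal {h₁ h₂ c₁ c₂ : ℂ} {u : U}
    (hu : u ∈ vermaIdeal h₁ h₂ c₁ c₂) :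
    wordRep (isCharacter_weight h₁ h₂ c₁ c₂) u emptyWord = 0 := by
  induction hu using Submodule.span_induction with
  | zero => simp
  | add a b _ _ ha hb => simp [ha, hb]
  | smul c a _ ha => simp [ha]
  | mem u hu =>
    obtain ⟨x, hx, rfl⟩ := hu
    have hx' : x ∈ Submodule.span ℂ (e '' {a | 0 ≤ key a}) := by
      simpa only [borel, key_nonneg_iff] using hx
    rw [map_sub, wordRep_toEnveloping, AlgHom.commutes]
    apply toWords_injective
    have := act_nil_of_mem_span (χ := weight h₁ h₂ c₁ c₂) hx'
    simp [toWords_actNormal, toWords_emptyWord, this, Module.algebraMap_end_apply]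

end BMS
end

/-! ### Filtration by number of letters, Euler operators and triangular lowering systems. -/

noncomputable section

namespace BMS

variable {V : Type*} [AddCommGroup V] [Module ℂ V]

/-- The filtration by number of letters: the span of the words with fewer than `n` letters
`a t`, `t ∈ J`, applied to vectors of `B`. -/
def wordFil (a : ℕ → Module.End ℂ V) (J : Set ℕ) (B : Submodule ℂ V) : ℕ → Submodule ℂ V
  -- Counting "fewer than `n`" letters makes stage 1 the base and stage 0 zero, so an operator that
  -- drops the stage by one kills the base.
  | 0 => ⊥
  | n + 1 => B ⊔ wordFil a J B n ⊔ ⨆ t ∈ J, (wordFil a J B n).map (a t)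

section wordFil

variable {a : ℕ → Module.End ℂ V} {J : Set ℕ} {B : Submodule ℂ V}

theorem le_wordFil_succ (n : ℕ) : B ≤ wordFil a J B (n + 1) :=
  le_sup_left.trans le_sup_left

theorem wordFil_le_succ (n : ℕ) : wordFil a J B n ≤ wordFil a J B (n + 1) :=
  le_sup_right.trans le_sup_left

theorem wordFil_monotone : Monotone (wordFil a J B) := monotone_nat_of_le_succ wordFil_le_succ

theorem apply_mem_wordFil {n t : ℕ} (ht : t ∈ J) {y : V} (hy : y ∈ wordFil a J B n) :
    a t y ∈ wordFil a J B (n + 1) :=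
  le_sup_right (a := B ⊔ wordFil a J B n)
    (Submodule.mem_iSup_of_mem t (Submodule.mem_iSup_of_mem ht ⟨y, hy, rfl⟩))

theorem wordFil_succ_le {n : ℕ} {G : Submodule ℂ V} (hB : B ≤ G) (h : wordFil a J B n ≤ G)
    (ha : ∀ t ∈ J, ∀ y ∈ wordFil a J B n, a t y ∈ G) : wordFil a J B (n + 1) ≤ G :=
  sup_le (sup_le hB h) (iSup₂_le fun t ht => Submodule.map_le_iff_le_comap.2 (ha t ht))

theorem wordFil_le {G : ℕ → Submodule ℂ V} (hB : ∀ n, B ≤ G (n + 1)) (hG : ∀ n, G n ≤ G (n + 1))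
    (ha : ∀ n, ∀ t ∈ J, ∀ y ∈ wordFil a J B n, y ∈ G n → a t y ∈ G (n + 1)) (n : ℕ) :
    wordFil a J B n ≤ G n := by
  induction n with
  | zero => exact bot_le
  | succ n ih =>
    exact wordFil_succ_le (hB n) (ih.trans (hG n)) fun t ht y hy => ha n t ht y hy (ih hy)

theorem wordFil_mono_set {J' : Set ℕ} (h : J ⊆ J') (n : ℕ) :
    wordFil a J B n ≤ wordFil a J' B n :=
  wordFil_le (fun _ => le_wordFil_succ _) wordFil_le_succ
    (fun _ _ ht _ _ hy => apply_mem_wordFil (h ht) hy) n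

theorem wordFil_one : wordFil a J B 1 = B :=
  le_antisymm (wordFil_succ_le le_rfl bot_le fun t _ y hy => by
    rw [(Submodule.mem_bot ℂ).1 hy, map_zero]
    exact zero_mem _) (le_wordFil_succ 0)

/-- A vector involves finitely many letters, which makes the Euler sum finite. -/
theorem exists_mem_wordFil_Iio {n : ℕ} {x : V} (hx : x ∈ wordFil a Set.univ B n) :
    ∃ K, x ∈ wordFil a (Set.Iio K) B n := by
  have hdir (n : ℕ) : Directed (· ≤ ·) fun K => wordFil a (Set.Iio K) B n :=
    Monotone.directed_le fun _ _ h => wordFil_mono_set (Set.Iio_subset_Iio h) n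
  have h : wordFil a Set.univ B n ≤ ⨆ K, wordFil a (Set.Iio K) B n := by
    refine wordFil_le (G := fun n => ⨆ K, wordFil a (Set.Iio K) B n) (fun n => ?_) (fun n => ?_)
      (fun n t _ y _ hy => ?_) n
    · exact le_iSup_of_le 0 (le_wordFil_succ n)
    · exact iSup_mono fun K => wordFil_le_succ n
    · obtain ⟨K, hK⟩ := (Submodule.mem_iSup_of_directed _ (hdir n)).1 hy
      refine Submodule.mem_iSup_of_mem (max K (t + 1)) (apply_mem_wordFil ?_
        (wordFil_mono_set (Set.Iio_subset_Iio (le_max_left _ _)) n hK))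
      exact Set.mem_Iio.2 (by omega)
  exact (Submodule.mem_iSup_of_directed _ (hdir n)).1 (h hx)

end wordFil

/-- If the operators `d s` act like partial derivatives in the letters `a t`, up to terms with
fewer letters, then the Euler operator `∑ a s * d s` counts letters. -/
theorem euler_mem_wordFil {a d : ℕ → Module.End ℂ V} {ε : ℂ} {K : ℕ} {B : Submodule ℂ V}
    (hd : ∀ q, ∀ x ∈ wordFil a (Set.Iio K) B (q + 1), ∀ s < K, d s x ∈ wordFil a Set.univ B q)
    (hda : ∀ q, ∀ y ∈ wordFil a (Set.Iio K) B (q + 1), ∀ s < K, ∀ t < K,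
      d s (a t y) - ε • a t (d s y) - (if s = t then y else 0) ∈ wordFil a Set.univ B q)
    (haa : ∀ q, ∀ z ∈ wordFil a Set.univ B q, ∀ s t,
      a s (a t z) - ε • a t (a s z) ∈ wordFil a Set.univ B (q + 1)) (q : ℕ) :
    ∀ x ∈ wordFil a (Set.Iio K) B (q + 1),
      ∑ s ∈ Finset.range K, a s (d s x) - (q : ℂ) • x ∈ wordFil a Set.univ B q := by
  have hle (n : ℕ) : wordFil a (Set.Iio K) B n ≤ wordFil a Set.univ B n :=
    wordFil_mono_set (Set.subset_univ _) n
  have hB : ∀ x ∈ B, ∑ s ∈ Finset.range K, a s (d s x) = 0 := by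
    refine fun x hx => Finset.sum_eq_zero fun s hs => ?_
    have h0 := hd 0 x (le_wordFil_succ 0 hx) s (Finset.mem_range.1 hs)
    rw [(Submodule.mem_bot ℂ).1 h0, map_zero]
  induction q with
  | zero =>
    intro x hx
    rw [zero_add, wordFil_one] at hx
    simp [hB x hx]
  | succ q ih =>
    let E : Module.End ℂ V := ∑ s ∈ Finset.range K, a s * d s
    have hE (x : V) : E x = ∑ s ∈ Finset.range K, a s (d s x) := by
      simp [E, LinearMap.sum_apply]
    have key : wordFil a (Set.Iio K) B (q + 1 + 1) ≤
        (wordFil a Set.univ B (q + 1)).comap (E - ((q + 1 : ℕ) : ℂ) • 1) := by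
      refine wordFil_succ_le (fun x hx => ?_) (fun x hx => ?_) (fun t ht y hy => ?_)
      · rw [Submodule.mem_comap, LinearMap.sub_apply, hE, hB x hx, zero_sub]
        exact neg_mem (Submodule.smul_mem _ _ (le_wordFil_succ q hx))
      · have h1 := wordFil_le_succ q (ih x hx)
        have h2 := sub_mem h1 (hle _ hx)
        rw [Submodule.mem_comap, LinearMap.sub_apply, hE]
        convert h2 using 1
        simp only [LinearMap.smul_apply, Module.End.one_apply]
        push_cast
        module
      · rw [Submodule.mem_comap, LinearMap.sub_apply, hE]
        -- Uses `[a_s d_s, a_t] = a_s (d_s a_t - ε a_t d_s) - (a_t a_s - ε a_s a_t) d_s`, the first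
        -- term being `δ_{st} a_t` up to shorter words and the second shorter.
        have h1 : ∑ s ∈ Finset.range K,
            (a s (d s (a t y) - ε • a t (d s y) - (if s = t then y else 0))
              - (a t (a s (d s y)) - ε • a s (a t (d s y)))) ∈ wordFil a Set.univ B (q + 1) := by
          refine sum_mem fun s hs => ?_
          rw [Finset.mem_range] at hs
          exact sub_mem (apply_mem_wordFil (Set.mem_univ s) (hda q y hy s hs t ht))
            (haa q _ (hd q y hy s hs) t s)
        have h2 := apply_mem_wordFil (Set.mem_univ t) (ih y hy)
        convert add_mem h1 h2 using 1
        have h3 : ∑ s ∈ Finset.range K, a s (if s = t then y else 0) = a t y := by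
          rw [Finset.sum_eq_single t]
          · simp
          · intro s _ hs
            simp [hs]
          · intro h
            exact absurd (Finset.mem_range.2 ht) h
        simp only [map_sub, map_sum, map_smul, Finset.sum_sub_distrib, h3,
          LinearMap.smul_apply, Module.End.one_apply]
        push_cast
        module
    intro x hx
    have := key hx
    rwa [Submodule.mem_comap, LinearMap.sub_apply, hE] at this

/-- Operators `g s` that lower the number of letters `a t`: the commutator of `g s` and `a t` is
the nonzero scalar `φ s` for `s = t`, an operator `m s t` for `s < t`, and zero for `s > t`, up to
an error in `R`. -/
structure IsLowering (a g : ℕ → Module.End ℂ V) (m : ℕ → ℕ → Module.End ℂ V) (φ : ℕ → ℂ) (ε : ℂ)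
    (B : Submodule ℂ V) (R : ℕ → Submodule ℂ V) : Prop where
  scalar_ne_zero : ∀ s, φ s ≠ 0
  error_le : ∀ q, R q ≤ wordFil a Set.univ B q
  apply_base : ∀ s, ∀ y ∈ B, g s y = 0
  apply_error : ∀ q s t, s < t → ∀ z ∈ R q, m s t z ∈ R q
  lower_raise : ∀ q s t, ∀ y ∈ wordFil a Set.univ B (q + 1),
    g s (a t y) - ε • a t (g s y) - (if s = t then φ s • y else 0)
      - (if s < t then m s t y else 0) ∈ R q
  shift_raise : ∀ q s t r, s < t → ∀ z ∈ wordFil a Set.univ B q,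
    m s t (a r z) - a r (m s t z) ∈ R q
  raise_raise : ∀ q, ∀ z ∈ wordFil a Set.univ B q, ∀ s t,
    a s (a t z) - ε • a t (a s z) ∈ wordFil a Set.univ B (q + 1)

/-- The triangular combinations of the `g t` that act like partial derivatives in the letters
`a s`, `s < K`. -/
def lowerOp (g : ℕ → Module.End ℂ V) (m : ℕ → ℕ → Module.End ℂ V) (φ : ℕ → ℂ) (K : ℕ) (s : ℕ) :
    Module.End ℂ V :=
  -- Back substitution in the triangular system `g_s = φ_s d_s + ∑_{s<t<K} m_{s,t} d_t`, from `s = K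
  -- - 1` down.
  (φ s)⁻¹ • (g s - ∑ t ∈ (Finset.Ioo s K).attach, m s t * lowerOp g m φ K t)
termination_by K - s
decreasing_by
  have := Finset.mem_Ioo.1 t.2
  omega

namespace IsLowering

variable {a g : ℕ → Module.End ℂ V} {m : ℕ → ℕ → Module.End ℂ V} {φ : ℕ → ℂ} {ε : ℂ}
  {B : Submodule ℂ V} {R : ℕ → Submodule ℂ V}

theorem smul_lowerOp (h : IsLowering a g m φ ε B R) (K s : ℕ) (x : V) :
    φ s • lowerOp g m φ K s x = g s x - ∑ t ∈ Finset.Ioo s K, m s t (lowerOp g m φ K t x) := by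
  rw [lowerOp, LinearMap.smul_apply, smul_smul, mul_inv_cancel₀ (h.scalar_ne_zero s), one_smul,
    LinearMap.sub_apply, LinearMap.sum_apply]
  congr 1
  exact Finset.sum_attach (Finset.Ioo s K) fun t => m s t (lowerOp g m φ K t x)

theorem mem_of_smul_mem {c : ℂ} (hc : c ≠ 0) {N : Submodule ℂ V} {x : V} (h : c • x ∈ N) :
    x ∈ N := by
  simpa [smul_smul, hc] using N.smul_mem c⁻¹ h

theorem lowerOp_mem_of_invariant (h : IsLowering a g m φ ε B R) {N : Submodule ℂ V}
    (hg : ∀ s, ∀ x ∈ N, g s x ∈ N) (hm : ∀ s t, s < t → ∀ x ∈ N, m s t x ∈ N) (K s : ℕ) :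
    ∀ x ∈ N, lowerOp g m φ K s x ∈ N := by
  induction hk : K - s using Nat.strong_induction_on generalizing s with
  | _ k ih =>
  intro x hx
  refine mem_of_smul_mem (h.scalar_ne_zero s) ?_
  rw [h.smul_lowerOp]
  refine sub_mem (hg s x hx) (sum_mem fun t ht => ?_)
  rw [Finset.mem_Ioo] at ht
  exact hm s t ht.1 _ (ih (K - t) (by omega) t rfl x hx)

/-- Downward induction on `s`: the unwanted term `m s t y` in the commutator of `g s` with `a t` is
cancelled by `m s t * d_t`, because `d_t a_t` contributes `y`. Moving `m s r` past `a t` costs an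
error controlled by the stage of `d_r y`, so the two claims are proved together. -/
theorem lowerOp_spec (h : IsLowering a g m φ ε B R) (K s : ℕ) :
    (∀ q, ∀ y ∈ wordFil a (Set.Iio K) B (q + 1), ∀ t < K,
      lowerOp g m φ K s (a t y) - ε • a t (lowerOp g m φ K s y) - (if s = t then y else 0) ∈ R q) ∧
    ∀ q, ∀ x ∈ wordFil a (Set.Iio K) B (q + 1),
      lowerOp g m φ K s x ∈ wordFil a Set.univ B q := by
  induction hk : K - s using Nat.strong_induction_on generalizing s with
  | _ k ih =>
  have ih' : ∀ r ∈ Finset.Ioo s K, s < r ∧ _ := fun r hr =>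
    ⟨(Finset.mem_Ioo.1 hr).1, ih (K - r) (by rw [Finset.mem_Ioo] at hr; omega) r rfl⟩
  have hle (n : ℕ) : wordFil a (Set.Iio K) B n ≤ wordFil a Set.univ B n :=
    wordFil_mono_set (Set.subset_univ _) n
  have hrel : ∀ q, ∀ y ∈ wordFil a (Set.Iio K) B (q + 1), ∀ t < K,
      lowerOp g m φ K s (a t y) - ε • a t (lowerOp g m φ K s y)
        - (if s = t then y else 0) ∈ R q := by
    intro q y hy t ht
    refine mem_of_smul_mem (h.scalar_ne_zero s) ?_
    have h1 := h.lower_raise q s t y (hle _ hy)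
    have h2 : ∑ r ∈ Finset.Ioo s K,
        (m s r (lowerOp g m φ K r (a t y) - ε • a t (lowerOp g m φ K r y)
          - (if r = t then y else 0))
        + ε • (m s r (a t (lowerOp g m φ K r y)) - a t (m s r (lowerOp g m φ K r y)))) ∈ R q := by
      refine sum_mem fun r hr => ?_
      obtain ⟨hsr, hr1, hr2⟩ := ih' r hr
      exact add_mem (h.apply_error q s r hsr _ (hr1 q y hy t ht))
        (Submodule.smul_mem _ _ (h.shift_raise q s r t hsr _ (hr2 q y hy)))
    have h3 : ∑ r ∈ Finset.Ioo s K, m s r (if r = t then y else 0) =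
        if s < t then m s t y else 0 := by
      split_ifs with hst
      · rw [Finset.sum_eq_single t]
        · simp
        · intro r _ hr
          simp [hr]
        · intro h
          exact absurd (Finset.mem_Ioo.2 ⟨hst, ht⟩) h
      · refine Finset.sum_eq_zero fun r hr => ?_
        rw [Finset.mem_Ioo] at hr
        rw [if_neg (by omega), map_zero]
    have e1 := h.smul_lowerOp K s (a t y)
    have e2 := congrArg (fun z => ε • a t z) (h.smul_lowerOp K s y)
    convert sub_mem h1 h2 using 1
    simp only [map_sub, map_sum, map_smul, Finset.sum_sub_distrib, Finset.sum_add_distrib, h3,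
      smul_sub, Finset.smul_sum, smul_ite, smul_zero] at e1 e2 ⊢
    rw [e1, smul_comm (φ s) ε, e2]
    abel
  refine ⟨hrel, fun q => ?_⟩
  have hB : ∀ x ∈ B, lowerOp g m φ K s x = 0 := by
    intro x hx
    have h0 := h.smul_lowerOp K s x
    rw [h.apply_base s x hx, Finset.sum_eq_zero, sub_zero] at h0
    · exact (smul_eq_zero.1 h0).resolve_left (h.scalar_ne_zero s)
    · intro r hr
      have := (ih' r hr).2.2 0 x (le_wordFil_succ 0 hx)
      rw [(Submodule.mem_bot ℂ).1 this, map_zero]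
  induction q with
  | zero =>
    intro x hx
    rw [zero_add, wordFil_one] at hx
    rw [hB x hx]
    exact zero_mem _
  | succ q ihq =>
    have : wordFil a (Set.Iio K) B (q + 1 + 1) ≤
        (wordFil a Set.univ B (q + 1)).comap (lowerOp g m φ K s) := by
      refine wordFil_succ_le (fun x hx => ?_) (fun x hx => ?_) (fun t ht y hy => ?_)
      · rw [Submodule.mem_comap, hB x hx]
        exact zero_mem _
      · exact wordFil_le_succ q (ihq x hx)
      · have h1 := wordFil_le_succ q (h.error_le q (hrel q y hy t ht))
        have h2 := Submodule.smul_mem _ ε (apply_mem_wordFil (Set.mem_univ t) (ihq y hy))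
        have h3 : (if s = t then y else 0) ∈ wordFil a Set.univ B (q + 1) := by
          split_ifs
          · exact hle _ hy
          · exact zero_mem _
        rw [Submodule.mem_comap]
        convert add_mem (add_mem h1 h2) h3 using 1
        abel
    exact fun x hx => this hx

/-- An invariant subspace that meets the span of all words meets the base. -/
theorem exists_mem_base (h : IsLowering a g m φ ε B R) {N : Submodule ℂ V}
    (hg : ∀ s, ∀ x ∈ N, g s x ∈ N) (hm : ∀ s t, s < t → ∀ x ∈ N, m s t x ∈ N) {n : ℕ} {x : V}
    (hx : x ∈ wordFil a Set.univ B n) (hxN : x ∈ N) (hx0 : x ≠ 0) :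
    ∃ y ∈ N, y ∈ B ∧ y ≠ 0 := by
  induction n using Nat.strong_induction_on generalizing x with
  | _ n ih =>
  match n with
  | 0 => exact absurd ((Submodule.mem_bot ℂ).1 hx) hx0
  | 1 => exact ⟨x, hxN, by rwa [wordFil_one] at hx, hx0⟩
  | q + 2 =>
    by_contra hcon
    -- If `N` misses the base, then by induction it contains no nonzero vector of a lower stage.
    have hbot : ∀ y ∈ wordFil a Set.univ B (q + 1), y ∈ N → y = 0 := by
      intro y hy hyN
      by_contra hy0
      exact hcon (ih (q + 1) (by omega) hy hyN hy0)
    obtain ⟨K, hK⟩ := exists_mem_wordFil_Iio hx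
    have hE := euler_mem_wordFil (d := lowerOp g m φ K) (ε := ε)
      (fun q x hx s _ => (h.lowerOp_spec K s).2 q x hx)
      (fun q y hy s _ t ht => h.error_le q ((h.lowerOp_spec K s).1 q y hy t ht))
      h.raise_raise (q + 1) x hK
    have hd (s : ℕ) : lowerOp g m φ K s x = 0 :=
      hbot _ ((h.lowerOp_spec K s).2 _ x hK) (h.lowerOp_mem_of_invariant hg hm K s x hxN)
    -- All derivatives of `x` vanish, so the Euler relation puts `(q + 1) x` in a lower stage; it
    -- also lies in `N`, hence is zero.
    simp only [hd, map_zero, Finset.sum_const_zero, zero_sub] at hE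
    have h0 := hbot _ hE (neg_mem (N.smul_mem _ hxN))
    rw [neg_eq_zero, smul_eq_zero] at h0
    rcases h0 with h0 | h0
    · exact absurd h0 (by exact_mod_cast Nat.succ_ne_zero q)
    · exact hx0 h0

end IsLowering

end BMS
end

/-! ### Operator form of the superalgebra and the three layers of words over a highest weight
vector. -/

noncomputable section

namespace BMS

variable {V : Type*} [AddCommGroup V] [Module ℂ V]

/-- The span of all words in the letters `a t` applied to vectors of `B`. -/
def wordSpan (a : ℕ → Module.End ℂ V) (B : Submodule ℂ V) : Submodule ℂ V :=
  ⨆ n, wordFil a Set.univ B n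

section wordSpan

variable {a : ℕ → Module.End ℂ V} {B : Submodule ℂ V}

theorem wordFil_le_wordSpan (n : ℕ) : wordFil a Set.univ B n ≤ wordSpan a B :=
  le_iSup (wordFil a Set.univ B) n

theorem mem_wordSpan {x : V} : x ∈ wordSpan a B ↔ ∃ n, x ∈ wordFil a Set.univ B n :=
  Submodule.mem_iSup_of_directed _ wordFil_monotone.directed_le

theorem le_wordSpan : B ≤ wordSpan a B := (le_wordFil_succ 0).trans (wordFil_le_wordSpan 1)

theorem apply_mem_wordSpan (t : ℕ) {y : V} (hy : y ∈ wordSpan a B) : a t y ∈ wordSpan a B := by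
  obtain ⟨n, hn⟩ := mem_wordSpan.1 hy
  exact wordFil_le_wordSpan (n + 1) (apply_mem_wordFil (Set.mem_univ t) hn)

theorem wordSpan_le {G : Submodule ℂ V} (hB : B ≤ G)
    (ha : ∀ t, ∀ y ∈ wordSpan a B, y ∈ G → a t y ∈ G) : wordSpan a B ≤ G :=
  iSup_le fun n => wordFil_le (G := fun _ => G) (fun _ => hB) (fun _ => le_rfl)
    (fun n t _ y hy hyG => ha t y (wordFil_le_wordSpan n hy) hyG) n

end wordSpan

variable (V) in
/-- An action of the `N = 1` BMS superalgebra on `V` on which the central elements act by the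
scalars `c₁` and `c₂`. The operator `Q n` has degree `n + 1/2`. -/
structure Action (c₁ c₂ : ℂ) where
  L : ℤ → Module.End ℂ V
  M : ℤ → Module.End ℂ V
  Q : ℤ → Module.End ℂ V
  L_L : ∀ m n y, L m (L n y) = L n (L m y) + (((m : ℂ) - n) • L (m + n) y
    + (if m + n = 0 then ((m : ℂ) ^ 3 - m) / 12 * c₁ else 0) • y)
  L_M : ∀ m n y, L m (M n y) = M n (L m y) + (((m : ℂ) - n) • M (m + n) y
    + (if m + n = 0 then ((m : ℂ) ^ 3 - m) / 12 * c₂ else 0) • y)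
  L_Q : ∀ m n y, L m (Q n y) = Q n (L m y) + ((m : ℂ) / 2 - (n + 1 / 2)) • Q (m + n) y
  M_M : ∀ m n y, M m (M n y) = M n (M m y)
  M_Q : ∀ m n y, M m (Q n y) = Q n (M m y)
  Q_Q : ∀ m n y, Q m (Q n y) = -Q n (Q m y) + ((2 : ℂ) • M (m + n + 1) y
    + (if m + n + 1 = 0 then (1 / 3 : ℂ) * (((m : ℂ) + 1 / 2) ^ 2 - 1 / 4) * c₂ else 0) • y)

namespace Action

variable {c₁ c₂ : ℂ} (A : Action V c₁ c₂)

theorem M_L (m n : ℤ) (y : V) : A.M m (A.L n y) = A.L n (A.M m y) + (((m : ℂ) - n) • A.M (m + n) y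
    + (if m + n = 0 then ((m : ℂ) ^ 3 - m) / 12 * c₂ else 0) • y) := by
  rw [A.L_M n m y, add_comm n m]
  split_ifs with h
  · have : (n : ℂ) = -m := by
      have : n = -m := by omega
      simp [this]
    rw [this]
    module
  · module

theorem Q_L (m n : ℤ) (y : V) :
    A.Q m (A.L n y) = A.L n (A.Q m y) - ((n : ℂ) / 2 - (m + 1 / 2)) • A.Q (n + m) y := by
  rw [A.L_Q n m y]
  abel

/-- The operators `L_{-1}, L_{-2}, …`. -/
def lowL (t : ℕ) : Module.End ℂ V := A.L (-(t + 1))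

/-- The operators `M_{-1}, M_{-2}, …`. -/
def lowM (t : ℕ) : Module.End ℂ V := A.M (-(t + 1))

/-- The operators `Q_{-1/2}, Q_{-3/2}, …`. -/
def lowQ (t : ℕ) : Module.End ℂ V := A.Q (-(t + 1))

theorem apply_neg {X : ℤ → Module.End ℂ V} {n : ℤ} (hn : n < 0) :
    X n = (fun t : ℕ => X (-(t + 1))) (-n - 1).toNat := by
  congr 1
  omega

theorem L_of_neg {n : ℤ} (hn : n < 0) : A.L n = A.lowL (-n - 1).toNat := apply_neg hn

theorem M_of_neg {n : ℤ} (hn : n < 0) : A.M n = A.lowM (-n - 1).toNat := apply_neg hn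

theorem Q_of_neg {n : ℤ} (hn : n < 0) : A.Q n = A.lowQ (-n - 1).toNat := apply_neg hn

/-- The span of the words in the `M`'s applied to `v`. -/
def spanM (v : V) : Submodule ℂ V := wordSpan A.lowM (ℂ ∙ v)

/-- The span of the words in the `M`'s and `Q`'s applied to `v`. -/
def spanQ (v : V) : Submodule ℂ V := wordSpan A.lowQ (A.spanM v)

/-- The span of the words with fewer than `n` letters `L`, and any number of letters `M` and `Q`,
applied to `v`. -/
def filL (v : V) (n : ℕ) : Submodule ℂ V := wordFil A.lowL Set.univ (A.spanQ v) n

/-- The span of all words applied to `v`. -/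
def spanL (v : V) : Submodule ℂ V := wordSpan A.lowL (A.spanQ v)

/-- `v` is a highest weight vector of weight `(h₁, h₂)`. -/
structure IsHighestWeight (h₁ h₂ : ℂ) (v : V) : Prop where
  L_zero : A.L 0 v = h₁ • v
  M_zero : A.M 0 v = h₂ • v
  L_pos : ∀ n, 0 < n → A.L n v = 0
  M_pos : ∀ n, 0 < n → A.M n v = 0
  Q_nonneg : ∀ n, 0 ≤ n → A.Q n v = 0

theorem self_mem_spanL (v : V) : v ∈ A.spanL v :=
  le_wordSpan (le_wordSpan (le_wordSpan (Submodule.mem_span_singleton_self v)))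

namespace IsHighestWeight

variable {A} {h₁ h₂ : ℂ} {v : V}

theorem M_mem_spanM (hv : A.IsHighestWeight h₁ h₂ v) (n : ℤ) {y : V} (hy : y ∈ A.spanM v) :
    A.M n y ∈ A.spanM v := by
  rcases lt_or_ge n 0 with hn | hn
  · rw [A.M_of_neg hn]
    exact apply_mem_wordSpan _ hy
  suffices h : A.spanM v ≤ (A.spanM v).comap (A.M n) from h hy
  refine wordSpan_le ?_ fun t y _ hyG => ?_
  · rw [Submodule.span_singleton_le_iff_mem, Submodule.mem_comap]
    rcases hn.eq_or_lt with rfl | hn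
    · rw [hv.M_zero]
      exact Submodule.smul_mem _ _ (le_wordSpan (Submodule.mem_span_singleton_self v))
    · rw [hv.M_pos n hn]
      exact zero_mem _
  · rw [Submodule.mem_comap, lowM, A.M_M]
    exact apply_mem_wordSpan t hyG

theorem M_pos_spanM (hv : A.IsHighestWeight h₁ h₂ v) {n : ℤ} (hn : 0 < n) {y : V}
    (hy : y ∈ A.spanM v) : A.M n y = 0 := by
  suffices h : A.spanM v ≤ LinearMap.ker (A.M n) from h hy
  refine wordSpan_le ?_ fun t y _ hyG => ?_
  · rw [Submodule.span_singleton_le_iff_mem, LinearMap.mem_ker, hv.M_pos n hn]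
  · rw [LinearMap.mem_ker] at hyG ⊢
    rw [lowM, A.M_M, hyG, map_zero]

theorem M_zero_spanM (hv : A.IsHighestWeight h₁ h₂ v) {y : V}
    (hy : y ∈ A.spanM v) : A.M 0 y = h₂ • y := by
  suffices h : A.spanM v ≤ LinearMap.eqLocus (A.M 0) (h₂ • LinearMap.id) from h hy
  refine wordSpan_le ?_ fun t y _ hyG => ?_
  · rw [Submodule.span_singleton_le_iff_mem]
    exact hv.M_zero
  · rw [LinearMap.mem_eqLocus] at hyG ⊢
    rw [lowM, A.M_M, hyG]
    simp

theorem Q_nonneg_spanM (hv : A.IsHighestWeight h₁ h₂ v) {n : ℤ} (hn : 0 ≤ n) {y : V}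
    (hy : y ∈ A.spanM v) : A.Q n y = 0 := by
  suffices h : A.spanM v ≤ LinearMap.ker (A.Q n) from h hy
  refine wordSpan_le ?_ fun t y _ hyG => ?_
  · rw [Submodule.span_singleton_le_iff_mem, LinearMap.mem_ker, hv.Q_nonneg n hn]
  · rw [LinearMap.mem_ker] at hyG ⊢
    rw [lowM, ← A.M_Q, hyG, map_zero]

theorem L_mem_spanM (hv : A.IsHighestWeight h₁ h₂ v) {n : ℤ} (hn : 0 ≤ n) {y : V}
    (hy : y ∈ A.spanM v) : A.L n y ∈ A.spanM v := by
  suffices h : A.spanM v ≤ (A.spanM v).comap (A.L n) from h hy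
  refine wordSpan_le ?_ fun t y hy hyG => ?_
  · rw [Submodule.span_singleton_le_iff_mem, Submodule.mem_comap]
    rcases hn.eq_or_lt with rfl | hn
    · rw [hv.L_zero]
      exact Submodule.smul_mem _ _ (le_wordSpan (Submodule.mem_span_singleton_self v))
    · rw [hv.L_pos n hn]
      exact zero_mem _
  · rw [Submodule.mem_comap, lowM, A.L_M]
    exact add_mem (apply_mem_wordSpan t hyG) (add_mem
      (Submodule.smul_mem _ _ (hv.M_mem_spanM _ hy)) (Submodule.smul_mem _ _ hy))

theorem M_mem_spanQ (hv : A.IsHighestWeight h₁ h₂ v) (n : ℤ) {y : V} (hy : y ∈ A.spanQ v) :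
    A.M n y ∈ A.spanQ v := by
  suffices h : A.spanQ v ≤ (A.spanQ v).comap (A.M n) from h hy
  refine wordSpan_le (fun y hy => le_wordSpan (hv.M_mem_spanM n hy)) fun t y _ hyG => ?_
  rw [Submodule.mem_comap, lowQ, A.M_Q]
  exact apply_mem_wordSpan t hyG

theorem M_pos_spanQ (hv : A.IsHighestWeight h₁ h₂ v) {n : ℤ} (hn : 0 < n) {y : V}
    (hy : y ∈ A.spanQ v) : A.M n y = 0 := by
  suffices h : A.spanQ v ≤ LinearMap.ker (A.M n) from h hy
  refine wordSpan_le (fun y hy => hv.M_pos_spanM hn hy) fun t y _ hyG => ?_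
  rw [LinearMap.mem_ker] at hyG ⊢
  rw [lowQ, A.M_Q, hyG, map_zero]

theorem M_zero_spanQ (hv : A.IsHighestWeight h₁ h₂ v) {y : V}
    (hy : y ∈ A.spanQ v) : A.M 0 y = h₂ • y := by
  suffices h : A.spanQ v ≤ LinearMap.eqLocus (A.M 0) (h₂ • LinearMap.id) from h hy
  refine wordSpan_le (fun y hy => hv.M_zero_spanM hy) fun t y _ hyG => ?_
  rw [LinearMap.mem_eqLocus] at hyG ⊢
  rw [lowQ, A.M_Q, hyG]
  simp

theorem Q_mem_spanQ (hv : A.IsHighestWeight h₁ h₂ v) (n : ℤ) {y : V} (hy : y ∈ A.spanQ v) :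
    A.Q n y ∈ A.spanQ v := by
  rcases lt_or_ge n 0 with hn | hn
  · rw [A.Q_of_neg hn]
    exact apply_mem_wordSpan _ hy
  suffices h : A.spanQ v ≤ (A.spanQ v).comap (A.Q n) from h hy
  refine wordSpan_le (fun y hy => ?_) fun t y hy hyG => ?_
  · rw [Submodule.mem_comap, hv.Q_nonneg_spanM hn hy]
    exact zero_mem _
  · rw [Submodule.mem_comap, lowQ, A.Q_Q]
    exact add_mem (neg_mem (apply_mem_wordSpan t hyG)) (add_mem
      (Submodule.smul_mem _ _ (hv.M_mem_spanQ _ hy)) (Submodule.smul_mem _ _ hy))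

theorem L_mem_spanQ (hv : A.IsHighestWeight h₁ h₂ v) {n : ℤ} (hn : 0 ≤ n) {y : V}
    (hy : y ∈ A.spanQ v) : A.L n y ∈ A.spanQ v := by
  suffices h : A.spanQ v ≤ (A.spanQ v).comap (A.L n) from h hy
  refine wordSpan_le (fun y hy => le_wordSpan (hv.L_mem_spanM hn hy)) fun t y hy hyG => ?_
  rw [Submodule.mem_comap, lowQ, A.L_Q]
  exact add_mem (apply_mem_wordSpan t hyG) (Submodule.smul_mem _ _ (hv.Q_mem_spanQ _ hy))

theorem M_mem_filL (hv : A.IsHighestWeight h₁ h₂ v) (n : ℤ) {q : ℕ} {y : V}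
    (hy : y ∈ A.filL v q) : A.M n y ∈ A.filL v q := by
  -- Commuting `M n` past a letter L changes its index, so all `n` are treated at once.
  suffices h : A.filL v q ≤ ⨅ n, (A.filL v q).comap (A.M n) from (Submodule.mem_iInf _).1 (h hy) n
  refine wordFil_le (G := fun q => ⨅ n, (A.filL v q).comap (A.M n)) (fun q y hy => ?_)
    (fun q y hy => ?_) (fun q t _ y hy hyG => ?_) q <;> rw [Submodule.mem_iInf] at * <;> intro n
  · exact le_wordFil_succ q (hv.M_mem_spanQ n hy)
  · exact wordFil_le_succ q (hy n)
  · rw [Submodule.mem_comap, lowL, A.M_L]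
    exact add_mem (apply_mem_wordFil (Set.mem_univ t) (hyG n)) (wordFil_le_succ q
      (add_mem (Submodule.smul_mem _ _ (hyG _)) (Submodule.smul_mem _ _ hy)))

/-- A positive M kills the words in M and Q, so it contributes only by being bracketed with some L,
which uses up that letter. -/
theorem M_pos_filL (hv : A.IsHighestWeight h₁ h₂ v) {n : ℤ} (hn : 0 < n) {q : ℕ} {y : V}
    (hy : y ∈ A.filL v (q + 1)) : A.M n y ∈ A.filL v q := by
  suffices h : A.filL v (q + 1) ≤ (A.filL v q).comap (A.M n) from h hy
  induction q generalizing y with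
  | zero =>
    intro y hy
    rw [filL, zero_add, wordFil_one] at hy
    rw [Submodule.mem_comap, hv.M_pos_spanQ hn hy]
    exact zero_mem _
  | succ q ih =>
    refine wordFil_succ_le (fun y hy => ?_) (fun y hy => ?_) (fun t _ y hy => ?_)
    · rw [Submodule.mem_comap, hv.M_pos_spanQ hn hy]
      exact zero_mem _
    · exact wordFil_le_succ q (ih hy hy)
    · rw [Submodule.mem_comap, lowL, A.M_L]
      exact add_mem (apply_mem_wordFil (Set.mem_univ t) (ih hy hy))
        (add_mem (Submodule.smul_mem _ _ (hv.M_mem_filL _ hy)) (Submodule.smul_mem _ _ hy))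

/-- On words in M and Q, `M 0` is exactly `h₂`; each bracket with a letter L consumes it. -/
theorem M_zero_filL (hv : A.IsHighestWeight h₁ h₂ v) {q : ℕ} {y : V}
    (hy : y ∈ A.filL v (q + 1)) : A.M 0 y - h₂ • y ∈ A.filL v q := by
  suffices h : A.filL v (q + 1) ≤ (A.filL v q).comap (A.M 0 - h₂ • (1 : Module.End ℂ V)) from h hy
  have hB : ∀ y ∈ A.spanQ v, (A.M 0 - h₂ • (1 : Module.End ℂ V)) y = 0 := fun y hy => by
    simp [hv.M_zero_spanQ hy]
  induction q generalizing y with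
  | zero =>
    intro y hy
    rw [filL, zero_add, wordFil_one] at hy
    rw [Submodule.mem_comap, hB y hy]
    exact zero_mem _
  | succ q ih =>
    refine wordFil_succ_le (fun y hy => ?_) (fun y hy => ?_) (fun t _ y hy => ?_)
    · rw [Submodule.mem_comap, hB y hy]
      exact zero_mem _
    · exact wordFil_le_succ q (ih hy hy)
    · have h1 := apply_mem_wordFil (Set.mem_univ t) (ih hy hy)
      rw [Submodule.mem_comap]
      convert add_mem h1 (add_mem (Submodule.smul_mem _ ((0 : ℤ) - (-(t + 1) : ℤ) : ℂ)
        (hv.M_mem_filL (0 + -(t + 1)) hy)) (Submodule.smul_mem _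
        (if (0 : ℤ) + -(t + 1) = 0 then (((0 : ℤ) : ℂ) ^ 3 - (0 : ℤ)) / 12 * c₂ else 0) hy)) using 1
      · rfl
      have h2 := A.M_L 0 (-(t + 1)) y
      simp only [LinearMap.sub_apply, LinearMap.smul_apply, Module.End.one_apply, map_sub, map_smul]
      rw [lowL, h2]
      abel

theorem Q_mem_filL (hv : A.IsHighestWeight h₁ h₂ v) (n : ℤ) {q : ℕ} {y : V}
    (hy : y ∈ A.filL v q) : A.Q n y ∈ A.filL v q := by
  suffices h : A.filL v q ≤ ⨅ n, (A.filL v q).comap (A.Q n) from (Submodule.mem_iInf _).1 (h hy) n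
  refine wordFil_le (G := fun q => ⨅ n, (A.filL v q).comap (A.Q n)) (fun q y hy => ?_)
    (fun q y hy => ?_) (fun q t _ y hy hyG => ?_) q <;> rw [Submodule.mem_iInf] at * <;> intro n
  · exact le_wordFil_succ q (hv.Q_mem_spanQ n hy)
  · exact wordFil_le_succ q (hy n)
  · rw [Submodule.mem_comap, lowL, A.Q_L]
    exact sub_mem (apply_mem_wordFil (Set.mem_univ t) (hyG n)) (wordFil_le_succ q
      (Submodule.smul_mem _ _ (hyG _)))

theorem L_mem_filL (hv : A.IsHighestWeight h₁ h₂ v) (n : ℤ) {q : ℕ} {y : V}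
    (hy : y ∈ A.filL v q) : A.L n y ∈ A.filL v (q + 1) := by
  suffices h : A.filL v q ≤ ⨅ n, (A.filL v (q + 1)).comap (A.L n) from
    (Submodule.mem_iInf _).1 (h hy) n
  refine wordFil_le (G := fun q => ⨅ n, (A.filL v (q + 1)).comap (A.L n)) (fun q y hy => ?_)
    (fun q y hy => ?_) (fun q t _ y hy hyG => ?_) q <;> rw [Submodule.mem_iInf] at * <;> intro n
  · rcases lt_or_ge n 0 with hn | hn
    · rw [A.L_of_neg hn]
      exact apply_mem_wordFil (Set.mem_univ _) (le_wordFil_succ q hy)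
    · exact le_wordFil_succ _ (hv.L_mem_spanQ hn hy)
  · exact wordFil_le_succ _ (hy n)
  · rw [Submodule.mem_comap, lowL, A.L_L]
    exact add_mem (apply_mem_wordFil (Set.mem_univ t) (hyG n)) (wordFil_le_succ _
      (add_mem (Submodule.smul_mem _ _ (hyG _)) (Submodule.smul_mem _ _ (wordFil_le_succ _ hy))))

theorem L_mem_spanL (hv : A.IsHighestWeight h₁ h₂ v) (n : ℤ) {y : V} (hy : y ∈ A.spanL v) :
    A.L n y ∈ A.spanL v := by
  obtain ⟨q, hq⟩ := mem_wordSpan.1 hy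
  exact wordFil_le_wordSpan _ (hv.L_mem_filL n hq)

theorem M_mem_spanL (hv : A.IsHighestWeight h₁ h₂ v) (n : ℤ) {y : V} (hy : y ∈ A.spanL v) :
    A.M n y ∈ A.spanL v := by
  obtain ⟨q, hq⟩ := mem_wordSpan.1 hy
  exact wordFil_le_wordSpan _ (hv.M_mem_filL n hq)

theorem Q_mem_spanL (hv : A.IsHighestWeight h₁ h₂ v) (n : ℤ) {y : V} (hy : y ∈ A.spanL v) :
    A.Q n y ∈ A.spanL v := by
  obtain ⟨q, hq⟩ := mem_wordSpan.1 hy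
  exact wordFil_le_wordSpan _ (hv.Q_mem_filL n hq)

end IsHighestWeight

end Action

end BMS
end

/-! ### The nondegenerate case: stripping L, Q and M letters. -/

noncomputable section

namespace BMS

namespace Action

variable {V : Type*} [AddCommGroup V] [Module ℂ V] {c₁ c₂ : ℂ} {A : Action V c₁ c₂} {h₁ h₂ : ℂ}
  {v : V}

/-- The scalar by which `[L_{s+1}, M_{-s-1}]` acts on a highest weight vector. -/
def scalarLM (h₂ c₂ : ℂ) (s : ℕ) : ℂ :=
  2 * ((s : ℂ) + 1) * h₂ + (((s : ℂ) + 1) ^ 3 - ((s : ℂ) + 1)) / 12 * c₂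

/-- The scalar is `2 (s + 1)` times the hypothesis quantity at `i = s + 1`. -/
theorem scalarLM_ne_zero (h : ∀ i : ℕ, 1 ≤ i → h₂ + ((i : ℂ) ^ 2 - 1) / 24 * c₂ ≠ 0) (s : ℕ) :
    scalarLM h₂ c₂ s ≠ 0 := by
  have h1 := h (s + 1) (by omega)
  have h2 : (s : ℂ) + 1 ≠ 0 := by exact_mod_cast Nat.succ_ne_zero s
  have : scalarLM h₂ c₂ s =
      2 * ((s : ℂ) + 1) * (h₂ + (((s + 1 : ℕ) : ℂ) ^ 2 - 1) / 24 * c₂) := by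
    rw [scalarLM]
    push_cast
    ring
  rw [this]
  exact mul_ne_zero (mul_ne_zero two_ne_zero h2) h1

/-- The shift operators that correct the partial derivatives in the letters `L` and `M`. -/
def shiftLM (A : Action V c₁ c₂) (s t : ℕ) : Module.End ℂ V :=
  ((s : ℂ) + t + 2) • A.M (s - t)

theorem cast_neg_succ (t : ℕ) : ((-((t : ℤ) + 1) : ℤ) : ℂ) = -((t : ℂ) + 1) := by push_cast; ring

theorem cast_succ_int (t : ℕ) : (((t : ℤ) + 1 : ℤ) : ℂ) = (t : ℂ) + 1 := by push_cast; ring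

namespace IsHighestWeight

/-- `[M_{s+1}, L_{-t-1}] = (s + t + 2) M_{s-t}` plus a central term. For `s > t` this removes an L,
for `s = t` it is a scalar up to fewer L's, and for `s < t` it is the shift operator. -/
theorem isLowering_L (hv : A.IsHighestWeight h₁ h₂ v)
    (h : ∀ i : ℕ, 1 ≤ i → h₂ + ((i : ℂ) ^ 2 - 1) / 24 * c₂ ≠ 0) :
    IsLowering A.lowL (fun s => A.M (s + 1)) A.shiftLM (scalarLM h₂ c₂) 1 (A.spanQ v)
      (A.filL v) where
  scalar_ne_zero := scalarLM_ne_zero h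
  error_le _ := le_rfl
  apply_base s y hy := hv.M_pos_spanQ (by omega) hy
  apply_error q s t _ z hz := Submodule.smul_mem _ _ (hv.M_mem_filL _ hz)
  lower_raise q s t y hy := by
    rw [lowL, A.M_L, cast_neg_succ, cast_succ_int,
      show ((s : ℤ) + 1 + -((t : ℤ) + 1)) = s - t by ring]
    rcases lt_trichotomy s t with hst | rfl | hst
    · rw [if_neg (by omega), if_neg (by omega), if_pos hst, shiftLM, LinearMap.smul_apply]
      convert zero_mem (A.filL v q) using 1
      module
    · rw [if_pos (by omega), if_pos rfl, if_neg (by omega), sub_self]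
      have h1 := hv.M_zero_filL hy
      convert Submodule.smul_mem _ (2 * ((s : ℂ) + 1)) h1 using 1
      rw [scalarLM]
      module
    · rw [if_neg (by omega), if_neg (by omega), if_neg (by omega)]
      have h1 := hv.M_pos_filL (n := s - t) (by omega) hy
      convert Submodule.smul_mem _ ((s : ℂ) + t + 2) h1 using 1
      module
  shift_raise q s t r hst z hz := by
    rw [shiftLM, lowL, LinearMap.smul_apply, LinearMap.smul_apply, map_smul, ← smul_sub, A.M_L,
      add_sub_cancel_left]
    exact Submodule.smul_mem _ _ (add_mem (Submodule.smul_mem _ _ (hv.M_mem_filL _ hz))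
      (Submodule.smul_mem _ _ hz))
  raise_raise q z hz s t := by
    rw [lowL, lowL, A.L_L, one_smul, add_sub_cancel_left]
    exact add_mem (Submodule.smul_mem _ _ (hv.L_mem_filL _ hz))
      (Submodule.smul_mem _ _ (wordFil_le_succ _ hz))

/-- The same brackets with the roles of L and M exchanged. There is no error term, because on words
in the M's `M 0` is exactly `h₂` and positive M's are exactly zero. -/
theorem isLowering_M (hv : A.IsHighestWeight h₁ h₂ v)
    (h : ∀ i : ℕ, 1 ≤ i → h₂ + ((i : ℂ) ^ 2 - 1) / 24 * c₂ ≠ 0) :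
    IsLowering A.lowM (fun s => A.L (s + 1)) A.shiftLM (scalarLM h₂ c₂) 1 (ℂ ∙ v)
      (fun _ => ⊥) where
  scalar_ne_zero := scalarLM_ne_zero h
  error_le _ := bot_le
  apply_base s y hy := by
    obtain ⟨c, rfl⟩ := Submodule.mem_span_singleton.1 hy
    rw [map_smul, hv.L_pos _ (by omega), smul_zero]
  apply_error q s t _ z hz := by
    rw [Submodule.mem_bot] at hz ⊢
    rw [hz, map_zero]
  lower_raise q s t y hy := by
    have hy' : y ∈ A.spanM v := wordFil_le_wordSpan _ hy
    rw [Submodule.mem_bot, lowM, A.L_M, cast_neg_succ, cast_succ_int,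
      show ((s : ℤ) + 1 + -((t : ℤ) + 1)) = s - t by ring]
    rcases lt_trichotomy s t with hst | rfl | hst
    · rw [if_neg (by omega), if_neg (by omega), if_pos hst, shiftLM, LinearMap.smul_apply]
      module
    · rw [if_pos (by omega), if_pos rfl, if_neg (by omega), sub_self, hv.M_zero_spanM hy',
        scalarLM]
      module
    · rw [if_neg (by omega), if_neg (by omega), if_neg (by omega),
        hv.M_pos_spanM (by omega) hy']
      module
  shift_raise q s t r hst z hz := by
    rw [Submodule.mem_bot, shiftLM, lowM, LinearMap.smul_apply, LinearMap.smul_apply, map_smul,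
      A.M_M, sub_self]
  raise_raise q z hz s t := by
    rw [lowM, lowM, A.M_M, one_smul, sub_self]
    exact zero_mem _

/-- The odd letters supercommute up to M's, hence `ε = -1`. `Q s` has degree `r = s + 1/2`, and `2
h₂ + (r² - 1/4) c₂ / 3` is twice the hypothesis quantity at the odd integer `i = 2s + 1`. -/
theorem isLowering_Q (hv : A.IsHighestWeight h₁ h₂ v)
    (h : ∀ i : ℕ, 1 ≤ i → h₂ + ((i : ℂ) ^ 2 - 1) / 24 * c₂ ≠ 0) :
    IsLowering A.lowQ (fun s => A.Q s) (fun s t => (2 : ℂ) • A.M (s - t))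
      (fun s => 2 * (h₂ + (((2 * s + 1 : ℕ) : ℂ) ^ 2 - 1) / 24 * c₂)) (-1) (A.spanM v)
      (fun _ => ⊥) where
  scalar_ne_zero s := mul_ne_zero two_ne_zero (h _ (by omega))
  error_le _ := bot_le
  apply_base s y hy := hv.Q_nonneg_spanM (by omega) hy
  apply_error q s t _ z hz := by
    rw [Submodule.mem_bot] at hz ⊢
    rw [hz, map_zero]
  lower_raise q s t y hy := by
    have hy' : y ∈ A.spanQ v := wordFil_le_wordSpan _ hy
    rw [Submodule.mem_bot, lowQ, A.Q_Q,
      show ((s : ℤ) + -((t : ℤ) + 1) + 1) = s - t by ring]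
    rcases lt_trichotomy s t with hst | rfl | hst
    · rw [if_neg (by omega), if_neg (by omega), if_pos hst, LinearMap.smul_apply]
      module
    · rw [if_pos (by omega), if_pos rfl, if_neg (by omega), sub_self, hv.M_zero_spanQ hy']
      push_cast
      module
    · rw [if_neg (by omega), if_neg (by omega), if_neg (by omega),
        hv.M_pos_spanQ (by omega) hy']
      module
  shift_raise q s t r hst z hz := by
    rw [Submodule.mem_bot, lowQ, LinearMap.smul_apply, LinearMap.smul_apply, map_smul,
      A.M_Q, sub_self]
  raise_raise q z hz s t := by
    rw [lowQ, lowQ, A.Q_Q]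
    have hle := wordFil_le_succ (a := A.lowQ) (J := Set.univ) (B := A.spanM v) q
    have hM : ∀ n : ℤ, ∀ q : ℕ, wordFil A.lowQ Set.univ (A.spanM v) q ≤
        (wordFil A.lowQ Set.univ (A.spanM v) q).comap (A.M n) := by
      intro n q
      refine wordFil_le (G := fun q => (wordFil A.lowQ Set.univ (A.spanM v) q).comap (A.M n))
        (fun q y hy => le_wordFil_succ q (hv.M_mem_spanM n hy)) (fun q y hy => wordFil_le_succ q hy)
        (fun q t _ y _ hyG => ?_) q
      rw [Submodule.mem_comap, lowQ, A.M_Q]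
      exact apply_mem_wordFil (Set.mem_univ t) hyG
    convert hle (add_mem (Submodule.smul_mem _ (2 : ℂ) (hM (-(s + 1) + -(t + 1) + 1) q hz))
      (Submodule.smul_mem _ (if (-((s : ℤ) + 1) + -(t + 1) + 1) = 0 then
        (1 / 3 : ℂ) * ((((-((s : ℤ) + 1) : ℤ) : ℂ) + 1 / 2) ^ 2 - 1 / 4) * c₂ else 0) hz)) using 1
    module

/-- In the nondegenerate case, an invariant subspace containing a nonzero word combination
contains the highest weight vector. -/
theorem mem_of_invariant (hv : A.IsHighestWeight h₁ h₂ v)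
    (h : ∀ i : ℕ, 1 ≤ i → h₂ + ((i : ℂ) ^ 2 - 1) / 24 * c₂ ≠ 0) {N : Submodule ℂ V}
    (hL : ∀ n, ∀ x ∈ N, A.L n x ∈ N) (hM : ∀ n, ∀ x ∈ N, A.M n x ∈ N)
    (hQ : ∀ n, ∀ x ∈ N, A.Q n x ∈ N) {x : V} (hx : x ∈ A.spanL v) (hxN : x ∈ N) (hx0 : x ≠ 0) :
    v ∈ N := by
  have hshift : ∀ s t : ℕ, s < t → ∀ x ∈ N, A.shiftLM s t x ∈ N := fun s t _ x hx =>
    N.smul_mem _ (hM _ x hx)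
  -- Each layer's base is the span of the next layer: L's are removed first, then Q's, then M's,
  -- down to the line through `v`.
  obtain ⟨n, hn⟩ := mem_wordSpan.1 hx
  obtain ⟨y, hyN, hy, hy0⟩ := (hv.isLowering_L h).exists_mem_base (fun s => hM _) hshift hn hxN hx0
  obtain ⟨n, hn⟩ := mem_wordSpan.1 hy
  obtain ⟨z, hzN, hz, hz0⟩ := (hv.isLowering_Q h).exists_mem_base (fun s => hQ _)
    (fun s t _ x hx => N.smul_mem _ (hM _ x hx)) hn hyN hy0
  obtain ⟨n, hn⟩ := mem_wordSpan.1 hz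
  obtain ⟨w, hwN, hw, hw0⟩ := (hv.isLowering_M h).exists_mem_base (fun s => hL _) hshift hn hzN hz0
  obtain ⟨c, rfl⟩ := Submodule.mem_span_singleton.1 hw
  refine IsLowering.mem_of_smul_mem (c := c) ?_ hwN
  rintro rfl
  exact hw0 (zero_smul _ _)

end IsHighestWeight

end Action

end BMS
end

/-! ### The degenerate case: a singular vector from the Frobenius recursion. -/

noncomputable section

namespace BMS

namespace Action

variable {V : Type*} [AddCommGroup V] [Module ℂ V] {c₁ c₂ : ℂ} (A : Action V c₁ c₂)

/-- The indicial polynomial of the recursion for the singular vector. -/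
def indicial (c₂ : ℂ) (i n : ℕ) : ℂ := -c₂ / 6 * n * ((n : ℂ) - i)

/-- The coefficients of the Frobenius series solution with base vector `v`, whose exponents differ
by `i`. -/
def frobenius (v : V) (i n : ℕ) : V :=
  if n = 0 then v
  else (indicial c₂ i n)⁻¹ • ∑ j : Fin n, A.M ((j : ℕ) - n) (frobenius v i j)

/-- The right-hand side of the Frobenius recursion; for `n = i` it is a singular vector. -/
def frobeniusSum (v : V) (i n : ℕ) : V :=
  ∑ j ∈ Finset.range n, A.M (j - n) (A.frobenius v i j)

theorem frobenius_zero (v : V) (i : ℕ) : A.frobenius v i 0 = v := by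
  rw [frobenius, if_pos rfl]

theorem frobenius_of_ne_zero (v : V) (i : ℕ) {n : ℕ} (hn : n ≠ 0) :
    A.frobenius v i n = (indicial c₂ i n)⁻¹ • A.frobeniusSum v i n := by
  rw [frobenius, if_neg hn, frobeniusSum, Finset.sum_range]

/-- The indicial polynomial has roots `0` and `i` only, so below `i` the recursion can be solved; at
`n = 0` both sides vanish. When `c₂ = 0` only `i = 1` is allowed, and nothing is divided. -/
theorem frobeniusSum_eq {v : V} {i n : ℕ} (hn : n < i) (hc : c₂ ≠ 0 ∨ i = 1) :
    A.frobeniusSum v i n = indicial c₂ i n • A.frobenius v i n := by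
  rcases Nat.eq_zero_or_pos n with rfl | hpos
  · simp [frobeniusSum, indicial]
  · rw [A.frobenius_of_ne_zero v i hpos.ne', smul_smul, mul_inv_cancel₀, one_smul]
    have hc' : c₂ ≠ 0 := hc.resolve_right (by omega)
    have h1 : (n : ℂ) ≠ 0 := by exact_mod_cast hpos.ne'
    have h2 : (n : ℂ) - i ≠ 0 := sub_ne_zero.2 (by exact_mod_cast hn.ne)
    exact mul_ne_zero (mul_ne_zero (div_ne_zero (neg_ne_zero.2 hc') (by norm_num)) h1) h2

namespace IsHighestWeight

variable {A} {h₁ h₂ : ℂ} {v : V}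

theorem frobenius_mem_spanM (hv : A.IsHighestWeight h₁ h₂ v) (i n : ℕ) :
    A.frobenius v i n ∈ A.spanM v := by
  induction n using Nat.strong_induction_on with
  | _ n ih =>
  rcases eq_or_ne n 0 with rfl | hn
  · rw [frobenius_zero]
    exact le_wordSpan (Submodule.mem_span_singleton_self v)
  · rw [A.frobenius_of_ne_zero v i hn]
    exact Submodule.smul_mem _ _ (sum_mem fun j hj =>
      hv.M_mem_spanM _ (ih j (Finset.mem_range.1 hj)))

theorem frobeniusSum_mem_spanM (hv : A.IsHighestWeight h₁ h₂ v) (i n : ℕ) :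
    A.frobeniusSum v i n ∈ A.spanM v :=
  sum_mem fun _ _ => hv.M_mem_spanM _ (hv.frobenius_mem_spanM i _)

theorem L_frobeniusSum_of_lt (hv : A.IsHighestWeight h₁ h₂ v) {i n m : ℕ} (hnm : n < m)
    (ih : ∀ j < n, A.L m (A.frobenius v i j) = 0) : A.L m (A.frobeniusSum v i n) = 0 := by
  rw [frobeniusSum, map_sum]
  refine Finset.sum_eq_zero fun j hj => ?_
  rw [Finset.mem_range] at hj
  -- As `n < m`, the bracket is a positive M, which kills words in the M's, and the central term
  -- does not occur.
  rw [A.L_M, ih j hj, hv.M_pos_spanM (by omega) (hv.frobenius_mem_spanM i j), if_neg (by omega)]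
  simp

/-- `L_m` lowers the index of a Frobenius coefficient by `m`, with a factor linear in the index.
Applied to the sum, the factors from `L_m y_j` and from `[L_m, M_{j-p-m}]` add up to a constant
independent of `j`, so the sum for `p` reappears; the term `j = p` of the bracket supplies `h₂` and
`c₂`. The rest is a polynomial identity using the relation between `h₂` and `c₂`. -/
theorem L_frobeniusSum_add (hv : A.IsHighestWeight h₁ h₂ v) {i p m : ℕ} (hm : 1 ≤ m)
    (hpi : p < i) (hc : c₂ ≠ 0 ∨ i = 1) (hf : h₂ + ((i : ℂ) ^ 2 - 1) / 24 * c₂ = 0)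
    (ih0 : ∀ j < m, A.L m (A.frobenius v i j) = 0)
    (ih : ∀ j < p, A.L m (A.frobenius v i (m + j)) =
      ((j : ℂ) + m - (3 * m + i) / 2) • A.frobenius v i j) :
    A.L m (A.frobeniusSum v i (p + m)) =
      (indicial c₂ i (p + m) * ((p : ℂ) + m - (3 * m + i) / 2)) • A.frobenius v i p := by
  have hM (j : ℕ) := hv.frobenius_mem_spanM i j
  have e1 : ∑ j ∈ Finset.range (p + m), A.M (j - (p + m : ℕ)) (A.L m (A.frobenius v i j)) =
      ∑ j ∈ Finset.range p, ((j : ℂ) + m - (3 * m + i) / 2) •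
        A.M (j - p) (A.frobenius v i j) := by
    rw [add_comm p m, Finset.sum_range_add, Finset.sum_eq_zero, zero_add]
    · refine Finset.sum_congr rfl fun j hj => ?_
      rw [ih j (Finset.mem_range.1 hj), map_smul]
      congr 3
      push_cast
      ring
    · intro j hj
      rw [ih0 j (Finset.mem_range.1 hj), map_zero]
  have e2 : ∑ j ∈ Finset.range (p + m),
      ((((m : ℤ) : ℂ) - ((j - (p + m : ℕ) : ℤ) : ℂ)) •
          A.M (m + (j - (p + m : ℕ))) (A.frobenius v i j)
        + (if (m : ℤ) + (j - (p + m : ℕ)) = 0 then (((m : ℤ) : ℂ) ^ 3 - ((m : ℤ) : ℂ)) / 12 * c₂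
          else 0) • A.frobenius v i j) =
      ∑ j ∈ Finset.range p, (2 * (m : ℂ) + p - j) • A.M (j - p) (A.frobenius v i j)
        + (2 * m * h₂ + ((m : ℂ) ^ 3 - m) / 12 * c₂) • A.frobenius v i p := by
    -- Splits the range into `j < p`, the central term `j = p`, and `r = m - 1` terms with `j > p`
    -- on which a positive M gives zero.
    obtain ⟨r, rfl⟩ : ∃ r, m = r + 1 := ⟨m - 1, by omega⟩
    rw [Finset.sum_range_add, Finset.sum_range_succ', Finset.sum_eq_zero (s := Finset.range r),
      zero_add]
    · congr 1
      · refine Finset.sum_congr rfl fun j hj => ?_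
        rw [Finset.mem_range] at hj
        rw [if_neg (by push_cast; omega), zero_smul, add_zero,
          show ((r + 1 : ℕ) : ℤ) + (j - (p + (r + 1) : ℕ)) = j - p by push_cast; ring]
        congr 1
        push_cast
        ring
      · rw [if_pos (by push_cast; omega),
          show ((r + 1 : ℕ) : ℤ) + ((p + 0 : ℕ) - (p + (r + 1) : ℕ)) = 0 by push_cast; ring,
          add_zero, hv.M_zero_spanM (hM p)]
        push_cast
        module
    · intro j hj
      rw [hv.M_pos_spanM (by push_cast; omega) (hM _), if_neg (by push_cast; omega)]
      simp
  have e3 : A.frobeniusSum v i p = ∑ j ∈ Finset.range p, A.M (j - p) (A.frobenius v i j) := rfl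
  have e4 := A.frobeniusSum_eq (v := v) hpi hc
  have hh : h₂ = -(((i : ℂ) ^ 2 - 1) / 24 * c₂) := eq_neg_of_add_eq_zero_left hf
  rw [frobeniusSum, map_sum, Finset.sum_congr rfl fun j _ => A.L_M _ _ _, Finset.sum_add_distrib,
    e1, e2, ← add_assoc, ← Finset.sum_add_distrib]
  have e5 : ∑ j ∈ Finset.range p, (((j : ℂ) + m - (3 * m + i) / 2) •
      A.M (j - p) (A.frobenius v i j) + (2 * (m : ℂ) + p - j) • A.M (j - p) (A.frobenius v i j)) =
      (3 * (m : ℂ) + p - (3 * m + i) / 2) • A.frobeniusSum v i p := by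
    rw [e3, Finset.smul_sum]
    refine Finset.sum_congr rfl fun j _ => ?_
    module
  rw [e5, e4, smul_smul, ← add_smul, hh]
  congr 1
  simp only [indicial]
  push_cast
  ring

theorem L_frobenius (hv : A.IsHighestWeight h₁ h₂ v) {i m : ℕ} (hm : 1 ≤ m)
    (hc : c₂ ≠ 0 ∨ i = 1) (hf : h₂ + ((i : ℂ) ^ 2 - 1) / 24 * c₂ = 0) (n : ℕ) (hn : n < i) :
    (n < m → A.L m (A.frobenius v i n) = 0) ∧
      ∀ p, n = m + p → A.L m (A.frobenius v i n) =
        ((p : ℂ) + m - (3 * m + i) / 2) • A.frobenius v i p := by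
  induction n using Nat.strong_induction_on with
  | _ n ih =>
  rcases eq_or_ne n 0 with rfl | hn0
  · refine ⟨fun _ => ?_, fun p hp => by omega⟩
    rw [frobenius_zero, hv.L_pos _ (by omega)]
  constructor
  · intro hnm
    rw [A.frobenius_of_ne_zero v i hn0, map_smul, hv.L_frobeniusSum_of_lt hnm, smul_zero]
    exact fun j hj => (ih j hj (by omega)).1 (by omega)
  · rintro p rfl
    have h0 := A.frobeniusSum_eq (v := v) hn hc
    rw [A.frobenius_of_ne_zero v i hn0, map_smul, add_comm m p,
      hv.L_frobeniusSum_add hm (by omega) hc hf (fun j hj => (ih j (by omega) (by omega)).1 hj)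
        (fun j hj => (ih (m + j) (by omega) (by omega)).2 j rfl), smul_smul, ← mul_assoc,
      inv_mul_cancel₀, one_mul]
    have hc' : c₂ ≠ 0 := hc.resolve_right (by omega)
    have h1 : ((p + m : ℕ) : ℂ) ≠ 0 := by exact_mod_cast (by omega : p + m ≠ 0)
    have h2 : ((p + m : ℕ) : ℂ) - i ≠ 0 := sub_ne_zero.2 (by exact_mod_cast (by omega : p + m ≠ i))
    exact mul_ne_zero (mul_ne_zero (div_ne_zero (neg_ne_zero.2 hc') (by norm_num)) h1) h2

theorem L_zero_frobenius (hv : A.IsHighestWeight h₁ h₂ v) (i n : ℕ) :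
    A.L 0 (A.frobenius v i n) = (h₁ + n) • A.frobenius v i n ∧
      A.L 0 (A.frobeniusSum v i n) = (h₁ + n) • A.frobeniusSum v i n := by
  induction n using Nat.strong_induction_on with
  | _ n ih =>
  have hsum : A.L 0 (A.frobeniusSum v i n) = (h₁ + n) • A.frobeniusSum v i n := by
    rw [frobeniusSum, map_sum, Finset.smul_sum]
    refine Finset.sum_congr rfl fun j hj => ?_
    rw [A.L_M, (ih j (Finset.mem_range.1 hj)).1, map_smul, zero_add]
    simp only [Int.cast_zero, Int.cast_sub, Int.cast_natCast, ne_eq, OfNat.ofNat_ne_zero,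
      not_false_eq_true, zero_pow, sub_zero, zero_div, zero_mul, ite_self, zero_smul, add_zero]
    module
  refine ⟨?_, hsum⟩
  rcases eq_or_ne n 0 with rfl | hn
  · rw [frobenius_zero, hv.L_zero]
    simp
  · rw [A.frobenius_of_ne_zero v i hn, map_smul, hsum, smul_comm]

/-- When the nondegeneracy condition fails at `i`, there is a singular vector of level `i`. -/
theorem frobeniusSum_isHighestWeight (hv : A.IsHighestWeight h₁ h₂ v) {i : ℕ} (hi : 1 ≤ i)
    (hc : c₂ ≠ 0 ∨ i = 1) (hf : h₂ + ((i : ℂ) ^ 2 - 1) / 24 * c₂ = 0) :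
    A.IsHighestWeight (h₁ + i) h₂ (A.frobeniusSum v i i) where
  L_zero := (hv.L_zero_frobenius i i).2
  M_zero := hv.M_zero_spanM (hv.frobeniusSum_mem_spanM i i)
  L_pos m hm := by
    lift m to ℕ using hm.le
    have hm' : 1 ≤ m := by omega
    have h := fun n hn => hv.L_frobenius (i := i) (v := v) hm' hc hf n hn
    rcases lt_or_ge i m with him | him
    · exact hv.L_frobeniusSum_of_lt him fun j hj => (h j hj).1 (by omega)
    · obtain ⟨p, rfl⟩ : ∃ p, i = p + m := ⟨i - m, by omega⟩
      rw [hv.L_frobeniusSum_add hm' (by omega) hc hf (fun j hj => (h j (by omega)).1 hj)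
        (fun j hj => (h (m + j) (by omega)).2 j rfl)]
      -- The factor is the indicial polynomial at its root `i`.
      simp [indicial]
  M_pos m hm := hv.M_pos_spanM hm (hv.frobeniusSum_mem_spanM i i)
  Q_nonneg n hn := hv.Q_nonneg_spanM hn (hv.frobeniusSum_mem_spanM i i)

/-- The levels of a highest weight module. -/
theorem spanL_le_iSup_eigenspace (hv : A.IsHighestWeight h₁ h₂ v) :
    A.spanL v ≤ ⨆ k : ℕ, Module.End.eigenspace (A.L 0) (h₁ + k / 2) := by
  set G := ⨆ k : ℕ, Module.End.eigenspace (A.L 0) (h₁ + k / 2) with hG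
  have step (X : Module.End ℂ V) (d : ℕ)
      (hX : ∀ y, A.L 0 (X y) = X (A.L 0 y) + ((d : ℂ) / 2) • X y) : G ≤ G.comap X := by
    refine iSup_le fun k y hy => ?_
    refine Submodule.mem_iSup_of_mem (k + d) ?_
    rw [Module.End.mem_eigenspace_iff] at hy ⊢
    rw [hX, hy, map_smul]
    push_cast
    module
  have hv0 : v ∈ G := by
    refine Submodule.mem_iSup_of_mem 0 ?_
    rw [Module.End.mem_eigenspace_iff, hv.L_zero]
    simp
  refine wordSpan_le (wordSpan_le (wordSpan_le ?_ fun t y _ hy => ?_) fun t y _ hy => ?_)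
    fun t y _ hy => ?_
  · rwa [Submodule.span_singleton_le_iff_mem]
  · refine step _ (2 * (t + 1)) (fun y => ?_) hy
    rw [lowM, A.L_M, zero_add]
    simp
  · refine step _ (2 * t + 1) (fun y => ?_) hy
    rw [lowQ, A.L_Q, zero_add]
    push_cast
    module
  · refine step _ (2 * (t + 1)) (fun y => ?_) hy
    rw [lowL, A.L_L, zero_add]
    simp

/-- The `L 0`-eigenvalues on the span of `w` are `h₁ + i + k/2` with `k ≥ 0`, never `h₁`, and
eigenspaces are independent. -/
theorem notMem_spanL (hv : A.IsHighestWeight h₁ h₂ v) (hv0 : v ≠ 0) {i : ℕ} (hi : 1 ≤ i) {w : V}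
    (hw : A.IsHighestWeight (h₁ + i) h₂ w) : v ∉ A.spanL w := by
  intro hmem
  have h1 := hw.spanL_le_iSup_eigenspace hmem
  have h2 : v ∈ Module.End.eigenspace (A.L 0) h₁ := by
    rw [Module.End.mem_eigenspace_iff, hv.L_zero]
  have hle : ⨆ k : ℕ, Module.End.eigenspace (A.L 0) (h₁ + i + k / 2) ≤
      ⨆ μ, ⨆ _ : μ ≠ h₁, Module.End.eigenspace (A.L 0) μ := by
    refine iSup_le fun k => le_iSup₂_of_le (h₁ + i + k / 2) ?_ le_rfl
    intro h
    have : ((2 * i + k : ℕ) : ℂ) = 0 := by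
      push_cast
      linear_combination 2 * h
    have : 2 * i + k = 0 := by exact_mod_cast this
    omega
  exact hv0 (Submodule.disjoint_def.1 (Module.End.eigenspaces_iSupIndep (A.L 0) h₁) v h2 (hle h1))

end IsHighestWeight

end Action

end BMS
end

/-! ### The Verma module as an instance, and its comparison with normal words. -/

noncomputable section

namespace BMS

/-- The generator of `U(𝔤)` given by a basis element. -/
abbrev gen (a : Label) : U := superalgebra.toEnveloping (e a)

theorem gen_mul_gen (a b : Label) :
    gen a * gen b = sgn a b • (gen b * gen a) + superalgebra.toEnveloping (bracketBasis a b) := by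
  have h := RingQuot.mkAlgHom_rel ℂ (LieSuperalgebra.EnvelopingRel.mk (S := superalgebra) a.parity
    b.parity (e a) (e b) (e_mem_part rfl) (e_mem_part rfl))
  rw [map_sub, map_smul, map_mul, map_mul, sub_eq_iff_eq_add] at h
  rw [← bracket_e, add_comm]
  exact h

section Module

variable {V : Type*} [AddCommGroup V] [Module ℂ V] [Module U V] [IsScalarTower ℂ U V]

theorem smul_mem_of_forall_gen {N : Submodule ℂ V} (h : ∀ a, ∀ y ∈ N, gen a • y ∈ N) (u : U) :
    ∀ y ∈ N, u • y ∈ N := by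
  obtain ⟨t, rfl⟩ := RingQuot.mkAlgHom_surjective ℂ superalgebra.EnvelopingRel u
  induction t using TensorAlgebra.induction with
  | algebraMap r =>
    intro y hy
    rw [AlgHom.commutes, algebraMap_smul]
    exact N.smul_mem r hy
  | ι x =>
    intro y hy
    change superalgebra.toEnveloping x • y ∈ N
    induction x using Finsupp.induction_linear with
    | zero => simp
    | add v w hv hw => simpa [add_smul] using add_mem hv hw
    | single a b =>
      have : Finsupp.single a b = b • e a := by simp
      rw [this, map_smul, smul_assoc]
      exact N.smul_mem _ (h a y hy)
  | mul s t hs ht =>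
    intro y hy
    rw [map_mul, mul_smul]
    exact hs _ (ht y hy)
  | add s t hs ht =>
    intro y hy
    rw [map_add, add_smul]
    exact add_mem (hs y hy) (ht y hy)

/-- The operator by which a basis element acts on a module. -/
def genEnd (V : Type*) [AddCommGroup V] [Module ℂ V] [Module U V] [IsScalarTower ℂ U V]
    (a : Label) : Module.End ℂ V where
  toFun y := gen a • y
  map_add' x y := smul_add _ x y
  map_smul' c y := by
    rw [RingHom.id_apply, ← algebraMap_smul U c y, smul_smul, ← Algebra.commutes, mul_smul,
      algebraMap_smul]

theorem genEnd_apply (a : Label) (y : V) : genEnd V a y = gen a • y := rfl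

theorem genEnd_genEnd (a b : Label) (y : V) : genEnd V a (genEnd V b y) =
    sgn a b • genEnd V b (genEnd V a y) + superalgebra.toEnveloping (bracketBasis a b) • y := by
  simp only [genEnd_apply]
  rw [smul_smul, gen_mul_gen, add_smul, smul_assoc, mul_smul]

/-- A module on which the central elements act by scalars, as a family of operators. -/
def moduleAction {c₁ c₂ : ℂ} (h1 : ∀ y : V, gen .c₁ • y = c₁ • y)
    (h2 : ∀ y : V, gen .c₂ • y = c₂ • y) : Action V c₁ c₂ where
  L n := genEnd V (.L n)
  M n := genEnd V (.M n)
  Q n := genEnd V (.Q n)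
  L_L m n y := by
    rw [genEnd_genEnd]
    simp only [sgn, Label.parity, ZMod.val_zero, mul_zero, pow_zero, one_smul, bracketBasis, map_add,
      map_smul, add_smul, smul_assoc, genEnd_apply, h1, smul_smul, ite_mul, zero_mul]
  L_M m n y := by
    rw [genEnd_genEnd]
    simp only [sgn, Label.parity, ZMod.val_zero, mul_zero, pow_zero, one_smul, bracketBasis, map_add,
      map_smul, add_smul, smul_assoc, genEnd_apply, h2, smul_smul, ite_mul, zero_mul]
  L_Q m n y := by
    rw [genEnd_genEnd]
    simp only [sgn, Label.parity, ZMod.val_zero, zero_mul, pow_zero, one_smul, bracketBasis,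
      map_smul, smul_assoc, genEnd_apply]
  M_M m n y := by
    rw [genEnd_genEnd]
    simp [sgn, Label.parity, bracketBasis]
  M_Q m n y := by
    rw [genEnd_genEnd]
    simp [sgn, Label.parity, bracketBasis]
  Q_Q m n y := by
    rw [genEnd_genEnd]
    have : sgn (.Q m) (.Q n) = -1 := by simp [sgn, Label.parity, ZMod.val_one]
    simp only [this, neg_smul, one_smul, bracketBasis, map_add, map_smul, add_smul, smul_assoc,
      genEnd_apply, h2, smul_smul, ite_mul, zero_mul]

end Module

section Verma

variable (h₁ h₂ c₁ c₂ : ℂ)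

instance vermaModule : Module ℂ (Verma h₁ h₂ c₁ c₂) := Submodule.Quotient.module' _

instance vermaSMul : SMul ℂ (Verma h₁ h₂ c₁ c₂) := (vermaModule h₁ h₂ c₁ c₂).toSMul

instance vermaIsScalarTower : IsScalarTower ℂ U (Verma h₁ h₂ c₁ c₂) :=
  ⟨fun r u x => by
    obtain ⟨y, rfl⟩ := Submodule.mkQ_surjective _ x
    change Submodule.Quotient.mk ((r • u) • y) = Submodule.Quotient.mk (r • (u • y))
    rw [smul_assoc]⟩

/-- The highest weight vector of the Verma module. -/
def highest : Verma h₁ h₂ c₁ c₂ := (vermaIdeal h₁ h₂ c₁ c₂).mkQ 1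

variable {h₁ h₂ c₁ c₂}

theorem exists_smul_highest (x : Verma h₁ h₂ c₁ c₂) : ∃ u : U, u • highest h₁ h₂ c₁ c₂ = x := by
  obtain ⟨u, rfl⟩ := Submodule.mkQ_surjective _ x
  refine ⟨u, ?_⟩
  rw [highest, ← map_smul, smul_eq_mul, mul_one]

theorem gen_smul_highest {a : Label} (ha : 0 ≤ key a) :
    gen a • highest h₁ h₂ c₁ c₂ = weightBasis h₁ h₂ c₁ c₂ a • highest h₁ h₂ c₁ c₂ := by
  rw [← algebraMap_smul U (weightBasis h₁ h₂ c₁ c₂ a)]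
  change Submodule.Quotient.mk (gen a • (1 : U)) =
    Submodule.Quotient.mk (algebraMap ℂ U (weightBasis h₁ h₂ c₁ c₂ a) • (1 : U))
  rw [Submodule.Quotient.eq, smul_eq_mul, smul_eq_mul, mul_one, mul_one]
  refine Submodule.subset_span ⟨e a, Submodule.subset_span ⟨a, (key_nonneg_iff a).1 ha, rfl⟩, ?_⟩
  rw [weight_e]

theorem verma_eq_top {N : Submodule ℂ (Verma h₁ h₂ c₁ c₂)} (hN : highest h₁ h₂ c₁ c₂ ∈ N)
    (h : ∀ a, ∀ y ∈ N, gen a • y ∈ N) (x : Verma h₁ h₂ c₁ c₂) : x ∈ N := by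
  obtain ⟨u, rfl⟩ := exists_smul_highest x
  exact smul_mem_of_forall_gen h u _ hN

/-- The vectors on which `z` acts by its weight form a subspace that is stable under all generators,
since `z` commutes with them, and contains the highest weight vector. -/
theorem central_smul {z : Label} (hz : ∀ a, bracketBasis z a = 0) (hz0 : z.parity = 0)
    (hzk : 0 ≤ key z) (x : Verma h₁ h₂ c₁ c₂) :
    gen z • x = weightBasis h₁ h₂ c₁ c₂ z • x := by
  let N : Submodule ℂ (Verma h₁ h₂ c₁ c₂) :=
    LinearMap.eqLocus (genEnd _ z) (weightBasis h₁ h₂ c₁ c₂ z • (1 : Module.End ℂ _))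
  have hN (x) : x ∈ N ↔ genEnd _ z x = weightBasis h₁ h₂ c₁ c₂ z • x := by
    rw [LinearMap.mem_eqLocus, LinearMap.smul_apply, Module.End.one_apply]
  rw [← genEnd_apply, ← hN]
  refine verma_eq_top ((hN _).2 (gen_smul_highest hzk)) (fun a y hy => ?_) x
  rw [hN] at hy ⊢
  rw [← genEnd_apply, genEnd_genEnd, hz, hy, map_smul]
  simp [sgn, hz0]

variable (h₁ h₂ c₁ c₂) in
/-- The action of the superalgebra on the Verma module. -/
def vermaAction : Action (Verma h₁ h₂ c₁ c₂) c₁ c₂ :=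
  moduleAction (central_smul (z := .c₁) (by rintro (_ | _ | _ | _ | _) <;> rfl) rfl le_rfl)
    (central_smul (z := .c₂) (by rintro (_ | _ | _ | _ | _) <;> rfl) rfl le_rfl)

theorem isHighestWeight_highest :
    (vermaAction h₁ h₂ c₁ c₂).IsHighestWeight h₁ h₂ (highest h₁ h₂ c₁ c₂) where
  L_zero := by
    refine (gen_smul_highest (a := .L 0) (by simp [key])).trans ?_
    simp [weightBasis]
  M_zero := by
    refine (gen_smul_highest (a := .M 0) (by simp [key])).trans ?_
    simp [weightBasis]
  L_pos n hn := by
    refine (gen_smul_highest (a := .L n) (by simp only [key]; omega)).trans ?_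
    simp [weightBasis, hn.ne']
  M_pos n hn := by
    refine (gen_smul_highest (a := .M n) (by simp only [key]; omega)).trans ?_
    simp [weightBasis, hn.ne']
  Q_nonneg n hn := by
    refine (gen_smul_highest (a := .Q n) (by simp only [key]; omega)).trans ?_
    simp [weightBasis]

theorem smul_mem_spanL {k₁ k₂ : ℂ} {w : Verma h₁ h₂ c₁ c₂}
    (hw : (vermaAction h₁ h₂ c₁ c₂).IsHighestWeight k₁ k₂ w) (u : U) :
    ∀ y ∈ (vermaAction h₁ h₂ c₁ c₂).spanL w, u • y ∈ (vermaAction h₁ h₂ c₁ c₂).spanL w := by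
  refine smul_mem_of_forall_gen (fun a y hy => ?_) u
  rcases a with n | n | n | _ | _
  · exact hw.L_mem_spanL n hy
  · exact hw.M_mem_spanL n hy
  · exact hw.Q_mem_spanL n hy
  · rw [central_smul (by rintro (_ | _ | _ | _ | _) <;> rfl) rfl le_rfl]
    exact Submodule.smul_mem _ _ hy
  · rw [central_smul (by rintro (_ | _ | _ | _ | _) <;> rfl) rfl le_rfl]
    exact Submodule.smul_mem _ _ hy

theorem mem_spanL_highest (x : Verma h₁ h₂ c₁ c₂) :
    x ∈ (vermaAction h₁ h₂ c₁ c₂).spanL (highest h₁ h₂ c₁ c₂) := by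
  obtain ⟨u, rfl⟩ := exists_smul_highest x
  exact smul_mem_spanL isHighestWeight_highest u _ (Action.self_mem_spanL _ _)

variable (h₁ h₂ c₁ c₂) in
/-- The map from the Verma module to its model on normal words. -/
theorem exists_map_normalWords : ∃ f : Verma h₁ h₂ c₁ c₂ →ₗ[ℂ] NormalWords,
    f (highest h₁ h₂ c₁ c₂) = emptyWord ∧
      ∀ a x, f (gen a • x) = actNormal (weight h₁ h₂ c₁ c₂) (e a) (f x) := by
  let ρ := wordRep (isCharacter_weight h₁ h₂ c₁ c₂)
  let _ : Module U NormalWords := Module.compHom NormalWords ρ.toRingHom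
  have hsmul (u : U) (t : NormalWords) : u • t = ρ u t := rfl
  let f : Verma h₁ h₂ c₁ c₂ →ₗ[U] NormalWords :=
    (vermaIdeal h₁ h₂ c₁ c₂).liftQ (LinearMap.toSpanSingleton U NormalWords emptyWord) (by
      intro u hu
      rw [LinearMap.mem_ker, LinearMap.toSpanSingleton_apply, hsmul]
      exact wordRep_emptyWord_of_mem_vermaIdeal hu)
  refine ⟨{ toFun := f, map_add' := map_add f, map_smul' := fun c x => ?_ }, ?_, fun a x => ?_⟩
  · rw [← algebraMap_smul U c x, map_smul, hsmul, AlgHom.commutes]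
    rfl
  · change f (highest h₁ h₂ c₁ c₂) = emptyWord
    simp only [f, highest, Submodule.mkQ_apply, Submodule.liftQ_apply,
      LinearMap.toSpanSingleton_apply, one_smul]
  · change f (gen a • x) = actNormal (weight h₁ h₂ c₁ c₂) (e a) (f x)
    rw [map_smul, hsmul]
    exact congrArg (fun g : Module.End ℂ NormalWords => g (f x)) (wordRep_toEnveloping _ _)

theorem highest_ne_zero : highest h₁ h₂ c₁ c₂ ≠ 0 := by
  intro h
  obtain ⟨f, hf, -⟩ := exists_map_normalWords h₁ h₂ c₁ c₂
  rw [h, map_zero] at hf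
  have := congrArg toWords hf
  rw [map_zero, toWords_emptyWord] at this
  exact one_ne_zero (Finsupp.single_eq_zero.1 this.symm)

/-- The M's commute without correction terms, so `M k` is merely inserted in its place. Hence
M-words have an exact length. -/
theorem exists_act_M {χ : Carrier →ₗ[ℂ] ℂ} {k : ℤ} (hk : k < 0) (l : List Label) (hl : IsNormal l)
    (hM : ∀ y ∈ l, ∃ j, y = .M j) :
    ∃ l', IsNormal l' ∧ l'.Perm (.M k :: l) ∧ act χ (e (.M k)) (word l) = word l' := by
  induction l with
  | nil =>
    have hn : IsNormal [.M k] := isNormal_singleton.2 (by simp only [key]; omega)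
    exact ⟨_, hn, List.Perm.refl _, act_of_isNormal hn⟩
  | cons y w ih =>
    by_cases hn : IsNormal (.M k :: y :: w)
    · exact ⟨_, hn, List.Perm.refl _, act_of_isNormal hn⟩
    obtain ⟨j, rfl⟩ := hM y List.mem_cons_self
    have hne : (Label.M k) ≠ .M j := by
      intro h
      refine hn ((isNormal_cons_cons hl).2 ⟨by simp only [key]; omega, .inr ⟨h, rfl⟩⟩)
    have hlt := not_isNormal_cons_cons hl hn hne
    obtain ⟨l', hl', hp, he⟩ := ih hl.tail fun y hy => hM y (List.mem_cons_of_mem _ hy)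
    have hc := hl.cons_of_perm hlt hl' hp
    refine ⟨_, hc, (hp.cons _).trans (List.Perm.swap _ _ _), ?_⟩
    rw [← act_of_isNormal (χ := χ) hl, act_of_key_lt hl hlt, he, act_of_isNormal hc, bracket_e]
    simp [sgn, Label.parity, bracketBasis]

/-- The span of the normal words in the letters `M` of length at least `r`. -/
def wordsM (r : ℕ) : Submodule ℂ Words :=
  Submodule.span ℂ (word '' {l | IsNormal l ∧ (∀ y ∈ l, ∃ j, y = .M j) ∧ r ≤ l.length})

theorem wordsM_antitone : Antitone wordsM := fun _ _ h =>
  Submodule.span_mono (Set.image_mono fun _ hl => ⟨hl.1, hl.2.1, h.trans hl.2.2⟩)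

theorem act_M_mem_wordsM {χ : Carrier →ₗ[ℂ] ℂ} {k : ℤ} (hk : k < 0) {r : ℕ} {t : Words}
    (ht : t ∈ wordsM r) : act χ (e (.M k)) t ∈ wordsM (r + 1) := by
  induction ht using Submodule.span_induction with
  | zero => simp
  | add a b _ _ ha hb => simpa using add_mem ha hb
  | smul c a _ ha => simpa using Submodule.smul_mem _ c ha
  | mem t ht =>
    obtain ⟨l, ⟨hl, hM, hr⟩, rfl⟩ := ht
    obtain ⟨l', hl', hp, he⟩ := exists_act_M (χ := χ) hk l hl hM
    rw [he]
    refine Submodule.subset_span ⟨l', ⟨hl', fun y hy => ?_, ?_⟩, rfl⟩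
    · rcases List.mem_cons.1 (hp.subset hy) with rfl | hy
      · exact ⟨k, rfl⟩
      · exact hM y hy
    · simpa [hp.length_eq] using hr

/-- In the model, the term `j = 0` is the one-letter word `M_{-i}`. For `j > 0` the coefficient
`y_j` already carries at least one M, so these terms have length at least two and cannot cancel it.
-/
theorem frobeniusSum_highest_ne_zero {i : ℕ} (hi : 1 ≤ i) :
    (vermaAction h₁ h₂ c₁ c₂).frobeniusSum (highest h₁ h₂ c₁ c₂) i i ≠ 0 := by
  intro h0
  obtain ⟨f, hf, hfa⟩ := exists_map_normalWords h₁ h₂ c₁ c₂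
  set A := vermaAction h₁ h₂ c₁ c₂
  set v := highest h₁ h₂ c₁ c₂
  let F : Verma h₁ h₂ c₁ c₂ →ₗ[ℂ] Words := toWords ∘ₗ f
  have hFv : F v = word [] := by
    change toWords (f v) = word []
    rw [hf, toWords_emptyWord]
  have hFM (k : ℤ) (x) : F (A.M k x) = act (weight h₁ h₂ c₁ c₂) (e (.M k)) (F x) := by
    change toWords (f (gen (.M k) • x)) = _
    rw [hfa, toWords_actNormal]
    rfl
  have hv0 : F v ∈ wordsM 0 := by
    rw [hFv]
    exact Submodule.subset_span ⟨[], ⟨isNormal_nil, by simp, by simp⟩, rfl⟩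
  have hmem (n : ℕ) : F (A.frobenius v i n) ∈ wordsM 0 ∧
      (n ≠ 0 → F (A.frobenius v i n) ∈ wordsM 1) := by
    induction n using Nat.strong_induction_on with
    | _ n ih =>
    rcases eq_or_ne n 0 with rfl | hn
    · rw [A.frobenius_zero]
      exact ⟨hv0, fun h => absurd rfl h⟩
    · suffices h : F (A.frobenius v i n) ∈ wordsM 1 from
        ⟨wordsM_antitone (Nat.zero_le 1) h, fun _ => h⟩
      rw [A.frobenius_of_ne_zero v i hn, map_smul, Action.frobeniusSum, map_sum]
      refine Submodule.smul_mem _ _ (sum_mem fun j hj => ?_)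
      rw [Finset.mem_range] at hj
      rw [hFM]
      exact act_M_mem_wordsM (by omega) (ih j hj).1
  obtain ⟨r, rfl⟩ : ∃ r, i = r + 1 := ⟨i - 1, by omega⟩
  have hk : ((0 : ℕ) : ℤ) - (r + 1 : ℕ) < 0 := by omega
  have hn : IsNormal [.M (((0 : ℕ) : ℤ) - (r + 1 : ℕ))] :=
    isNormal_singleton.2 (by simp only [key]; omega)
  have h1 := congrArg F h0
  rw [Action.frobeniusSum, Finset.sum_range_succ', map_add, map_zero, hFM, A.frobenius_zero, hFv,
    act_of_isNormal hn, map_sum] at h1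
  have h2 : ∑ j ∈ Finset.range r, F (A.M ((j + 1 : ℕ) - (r + 1 : ℕ))
      (A.frobenius v (r + 1) (j + 1))) ∈ wordsM 2 := by
    refine sum_mem fun j hj => ?_
    rw [Finset.mem_range] at hj
    rw [hFM]
    exact act_M_mem_wordsM (by omega) ((hmem (j + 1)).2 (Nat.succ_ne_zero j))
  have h3 : ∀ t ∈ wordsM 2, t [.M (((0 : ℕ) : ℤ) - (r + 1 : ℕ))] = 0 := by
    intro t ht
    induction ht using Submodule.span_induction with
    | zero => simp
    | add a b _ _ ha hb => rw [Finsupp.add_apply, ha, hb, add_zero]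
    | smul c a _ ha => rw [Finsupp.smul_apply, ha, smul_zero]
    | mem t ht =>
      obtain ⟨l, ⟨-, -, hl⟩, rfl⟩ := ht
      refine Finsupp.single_eq_of_ne ?_
      rintro rfl
      simp at hl
  have h4 := DFunLike.congr_fun h1 [.M (((0 : ℕ) : ℤ) - (r + 1 : ℕ))]
  rw [Finsupp.add_apply, h3 _ h2, Finsupp.single_eq_same] at h4
  simp at h4

end Verma

end BMS

end

/-! ### The simplicity criterion. -/

open BMS in
theorem theorem3p2 (h₁ h₂ c₁ c₂ : ℂ) :
    IsSimpleModule BMS.U (BMS.Verma h₁ h₂ c₁ c₂) ↔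
      ∀ i : ℕ, 1 ≤ i → h₂ + ((i : ℂ) ^ 2 - 1) / 24 * c₂ ≠ 0 := by
  have hv := isHighestWeight_highest (h₁ := h₁) (h₂ := h₂) (c₁ := c₁) (c₂ := c₂)
  have hv0 := highest_ne_zero (h₁ := h₁) (h₂ := h₂) (c₁ := c₁) (c₂ := c₂)
  constructor
  · intro hsimple
    by_contra! hcon
    -- If `c₂ = 0` the failing condition reads `h₂ = 0` for every `i`, so `i = 1` may be chosen.
    obtain ⟨i, hi, hc, hf⟩ : ∃ i : ℕ, 1 ≤ i ∧ (c₂ ≠ 0 ∨ i = 1) ∧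
        h₂ + ((i : ℂ) ^ 2 - 1) / 24 * c₂ = 0 := by
      obtain ⟨i, hi, hf⟩ := hcon
      rcases eq_or_ne c₂ 0 with hc | hc
      · exact ⟨1, le_rfl, .inr rfl, by simpa [hc] using hf⟩
      · exact ⟨i, hi, .inl hc, hf⟩
    have hw := hv.frobeniusSum_isHighestWeight hi hc hf
    have hw0 := frobeniusSum_highest_ne_zero (h₁ := h₁) (h₂ := h₂) (c₁ := c₁) (c₂ := c₂) hi
    set w := (vermaAction h₁ h₂ c₁ c₂).frobeniusSum (highest h₁ h₂ c₁ c₂) i i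
    refine hv.notMem_spanL hv0 hi hw ?_
    -- Simplicity would make the singular vector generate everything, in particular the highest
    -- weight vector.
    have htop : Submodule.span U {w} = ⊤ :=
      (eq_bot_or_eq_top _).resolve_left fun h => hw0 (Submodule.span_singleton_eq_bot.1 h)
    have hmem : highest h₁ h₂ c₁ c₂ ∈ Submodule.span U {w} := htop ▸ Submodule.mem_top
    obtain ⟨u, hu⟩ := Submodule.mem_span_singleton.1 hmem
    rw [← hu]
    exact smul_mem_spanL hw u w (Action.self_mem_spanL _ _)
  · intro h
    have : Nontrivial (Verma h₁ h₂ c₁ c₂) := ⟨_, _, hv0⟩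
    refine { eq_bot_or_eq_top := fun N => ?_ }
    rw [or_iff_not_imp_left, Submodule.eq_bot_iff]
    intro hN
    push Not at hN
    obtain ⟨x, hxN, hx0⟩ := hN
    have hmem : highest h₁ h₂ c₁ c₂ ∈ N.restrictScalars ℂ :=
      hv.mem_of_invariant h (fun n x hx => N.smul_mem (gen (.L n)) hx)
        (fun n x hx => N.smul_mem (gen (.M n)) hx) (fun n x hx => N.smul_mem (gen (.Q n)) hx)
        (mem_spanL_highest x) hxN hx0
    refine Submodule.eq_top_iff'.2 fun y => ?_
    obtain ⟨u, rfl⟩ := exists_smul_highest y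
    exact N.smul_mem u hmem
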